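/- Let $k$ be a field, let $A$ and $B$ be finite dimensional $k$-algebras, $\Lambda:=A\otimes_kB$, and $\mathrm{D}=\mathrm{Hom}_k(-,k)$. Modules are finitely generated left modules unless stated otherwise. Let $\mathrm{Mon}(B,A)$ be the full subcategory of $\Lambda\text{-mod}$ of all $X$ with $\mathrm{Tor}_i^{\Lambda}(A\otimes_k\mathrm{D}(S),X)=0$ for all $i\ge 1$ and all simple left $B$-modules $S$. Let $A\text{-Gproj}$ be the category of Gorenstein projective $A$-modules, i.e. modules isomorphic to $\mathrm{Ker}(d^1)$ for some exact complex $P^\bullet$ (indexed by $\mathbb{Z}$) of finitely generated projective $A$-modules such that $\mathrm{Hom}_A(P^\bullet,A)$ is exact, and let $\mathrm{Mon}(B,A\text{-Gproj})$ be the full subcategory of all $X\in\mathrm{Mon}(B,A)$ such that $(A\otimes_kV)\otimes_\Lambda X\in A\text{-Gproj}$ for every finitely generated right $B$-module $V$. A full subcategory $\mathscr{X}$ of $\Lambda\text{-mod}$ that contains $0$ and is closed under extensions is regarded as an exact category whose conflations are the short exact sequences of $\Lambda$-modules with all terms in $\mathscr{X}$; it is Frobenius if it has enough projective objects and enough injective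 objects (with respect to these conflations) and its projective objects coincide with its injective objects. Then $\mathrm{Mon}(B,A\text{-Gproj})$ is a Frobenius exact category, and its projective-injective objects are exactly the finitely generated projective $\Lambda$-modules. Moreover, if $B\neq 0$, the following are equivalent: 1. the exact category $\mathrm{Mon}(B,A)$ is Frobenius; 2. $A$ is selfinjective, i.e. ${}_AA$ is an injective $A$-module; 3. $\mathrm{Mon}(B,A)=\mathrm{Mon}(B,A\text{-Gproj})$. -/

import Mathlib

open CategoryTheory
open scoped TensorProduct MulOpposite

universe u

namespace MonRep

noncomputable section

/-! ## Tensor products and Tor over a noncommutative ring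

Right `R`-modules are modules over `Rᵐᵒᵖ`. -/

section Balanced

variable (T R : Type u) [Ring T] [Ring R] (M : Type u) [AddCommGroup M] [Module T M]
  [Module Rᵐᵒᵖ M]

/-- For a `T`-`R`-bimodule `M` and a left `R`-module `X`, the `T`-submodule of `M ⊗[ℤ] X` generated
by the elements `m r ⊗ x - m ⊗ r x`. (As the two actions on `M` commute, the additive subgroup
generated by these elements is the same.) -/
def balancedRel (X : Type u) [AddCommGroup X] [Module R X] : Submodule T (M ⊗[ℤ] X) :=
  Submodule.span T
    {z | ∃ (m : M) (r : R) (x : X), z = (MulOpposite.op r • m) ⊗ₜ[ℤ] x - m ⊗ₜ[ℤ] (r • x)}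

/-- The left `T`-module `M ⊗_R X`, for a `T`-`R`-bimodule `M` and a left `R`-module `X`. -/
abbrev BalancedTensor [SMulCommClass T Rᵐᵒᵖ M] (X : Type u) [AddCommGroup X] [Module R X] :
    Type u :=
  (M ⊗[ℤ] X) ⧸ balancedRel T R M X

variable [SMulCommClass T Rᵐᵒᵖ M]

/-- The `T`-linear map `M ⊗_R X → M ⊗_R Y`, `m ⊗ x ↦ m ⊗ f x`. -/
def balancedMap {X Y : Type u} [AddCommGroup X] [Module R X] [AddCommGroup Y] [Module R Y]
    (f : X →ₗ[R] Y) : BalancedTensor T R M X →ₗ[T] BalancedTensor T R M Y :=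
  Submodule.mapQ _ _
    (TensorProduct.AlgebraTensorModule.map (LinearMap.id : M →ₗ[T] M)
      f.toAddMonoidHom.toIntLinearMap)
    (by
      rw [balancedRel, Submodule.span_le]
      rintro _ ⟨m, r, x, rfl⟩
      refine Submodule.subset_span ⟨m, r, f x, ?_⟩
      simp)

@[simp]
theorem balancedMap_mk {X Y : Type u} [AddCommGroup X] [Module R X] [AddCommGroup Y] [Module R Y]
    (f : X →ₗ[R] Y) (m : M) (x : X) :
    balancedMap T R M f (Submodule.Quotient.mk (m ⊗ₜ[ℤ] x)) =
      Submodule.Quotient.mk (m ⊗ₜ[ℤ] f x) := by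
  simp [balancedMap]

variable {T R M} in
theorem balanced_hom_ext {X : Type u} [AddCommGroup X] [Module R X]
    {N : Type u} [AddCommGroup N] [Module T N] {f g : BalancedTensor T R M X →ₗ[T] N}
    (h : ∀ (m : M) (x : X), f (Submodule.Quotient.mk (m ⊗ₜ[ℤ] x)) =
      g (Submodule.Quotient.mk (m ⊗ₜ[ℤ] x))) : f = g := by
  apply Submodule.linearMap_qext
  apply TensorProduct.AlgebraTensorModule.ext
  exact h

/-- The functor `M ⊗_R -` from left `R`-modules to left `T`-modules, for a `T`-`R`-bimodule `M`. -/
def tensorFunctor : ModuleCat.{u} R ⥤ ModuleCat.{u} T where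
  obj X := ModuleCat.of T (BalancedTensor T R M X)
  map f := ModuleCat.ofHom (balancedMap T R M f.hom)
  map_id X := by
    apply ModuleCat.hom_ext
    apply balanced_hom_ext
    intro m x
    simp
  map_comp f g := by
    apply ModuleCat.hom_ext
    apply balanced_hom_ext
    intro m x
    simp

instance : (tensorFunctor T R M).Additive where
  map_add {X Y f g} := by
    apply ModuleCat.hom_ext
    apply balanced_hom_ext
    intro m x
    change balancedMap T R M (f.hom + g.hom) _ =
      balancedMap T R M f.hom _ + balancedMap T R M g.hom _
    simp only [balancedMap_mk, LinearMap.add_apply, TensorProduct.tmul_add,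
      Submodule.Quotient.mk_add]

/-- `Tor_i^R(M, X)` (as a left `T`-module), for a `T`-`R`-bimodule `M` and a left `R`-module `X`. -/
def torModule (i : ℕ) (X : ModuleCat.{u} R) : ModuleCat.{u} T :=
  ((tensorFunctor T R M).leftDerived i).obj X

end Balanced

/-! ## The right module `D(S)` and the bimodule `A ⊗ V` -/

section Dual

variable (k B S : Type u) [Field k] [Ring B] [Algebra k B] [AddCommGroup S] [Module k S]
  [Module B S] [IsScalarTower k B S]

/-- `D(S) = Hom_k(S, k)` for a left `B`-module `S`, with the right `B`-action
`(φ b)(s) = φ (b s)`. -/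
def RightDual : Type u := S →ₗ[k] k

instance : AddCommGroup (RightDual k S) := inferInstanceAs (AddCommGroup (S →ₗ[k] k))

instance : Module k (RightDual k S) := inferInstanceAs (Module k (S →ₗ[k] k))

instance : Module Bᵐᵒᵖ (RightDual k S) where
  smul b φ := (show S →ₗ[k] k from φ) ∘ₗ Algebra.lsmul k k S b.unop
  one_smul φ := by
    refine LinearMap.ext fun s => ?_
    change (show S →ₗ[k] k from φ) ((1 : B) • s) = (show S →ₗ[k] k from φ) s
    rw [one_smul]
  mul_smul b c φ := by
    refine LinearMap.ext fun s => ?_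
    change (show S →ₗ[k] k from φ) ((c.unop * b.unop) • s) =
      (show S →ₗ[k] k from φ) (c.unop • b.unop • s)
    rw [mul_smul]
  smul_zero b := rfl
  smul_add b φ ψ := rfl
  add_smul b c φ := by
    refine LinearMap.ext fun s => ?_
    change (show S →ₗ[k] k from φ) ((b.unop + c.unop) • s) =
      (show S →ₗ[k] k from φ) (b.unop • s) + (show S →ₗ[k] k from φ) (c.unop • s)
    rw [add_smul, map_add]
  zero_smul φ := by
    refine LinearMap.ext fun s => ?_
    change (show S →ₗ[k] k from φ) ((0 : B) • s) = 0
    rw [zero_smul, map_zero]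

instance : IsScalarTower k Bᵐᵒᵖ (RightDual k S) where
  smul_assoc c b φ := by
    refine LinearMap.ext fun s => ?_
    change (show S →ₗ[k] k from φ) ((c • b.unop) • s) =
      c • (show S →ₗ[k] k from φ) (b.unop • s)
    rw [smul_assoc, map_smul]

end Dual

section Ind

variable (k A B : Type u) [Field k] [Ring A] [Algebra k A] [Ring B] [Algebra k B]
  (V : Type u) [AddCommGroup V] [Module k V]

/-- `A ⊗_k V`, for a right `B`-module `V`, as an `A`-`(A ⊗_k B)`-bimodule: the actions are
`a' (a ⊗ v) = a' a ⊗ v` and `(a ⊗ v) (a' ⊗ b) = a a' ⊗ v b`. -/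
def Ind : Type u := A ⊗[k] V

instance : AddCommGroup (Ind k A V) := inferInstanceAs (AddCommGroup (A ⊗[k] V))

instance : Module A (Ind k A V) := inferInstanceAs (Module A (A ⊗[k] V))

variable [Module Bᵐᵒᵖ V] [IsScalarTower k Bᵐᵒᵖ V]

/-- The action of `Aᵐᵒᵖ ⊗_k Bᵐᵒᵖ` on `A ⊗_k V` given by right multiplication on both factors. -/
def indActionAux : Aᵐᵒᵖ ⊗[k] Bᵐᵒᵖ →ₐ[k] Module.End A (A ⊗[k] V) :=
  (Module.endTensorEndAlgHom (R := k) (S := k) (A := A) (M := A) (N := V)).comp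
    (Algebra.TensorProduct.map (Algebra.lsmul k A A : Aᵐᵒᵖ →ₐ[k] Module.End A A)
      (Algebra.lsmul k k V : Bᵐᵒᵖ →ₐ[k] Module.End k V))

/-- The right action of `A ⊗_k B` on `A ⊗_k V`, as an algebra homomorphism into the
`A`-linear endomorphisms of `A ⊗_k V`. -/
def indAction : (A ⊗[k] B)ᵐᵒᵖ →ₐ[k] Module.End A (A ⊗[k] V) :=
  (indActionAux k A B V).comp (Algebra.TensorProduct.opAlgEquiv k k A B).symm.toAlgHom

instance : Module (A ⊗[k] B)ᵐᵒᵖ (Ind k A V) :=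
  Module.compHom (A ⊗[k] V) (indAction k A B V).toRingHom

/-- The right action of `Λ = A ⊗_k B` on `A ⊗_k V` is given by `(a ⊗ v) (a' ⊗ b) = a a' ⊗ v b`. -/
theorem ind_op_smul_tmul (a a' : A) (b : B) (v : V) :
    MulOpposite.op (a' ⊗ₜ[k] b) • (show Ind k A V from a ⊗ₜ[k] v) =
      (show Ind k A V from (a * a') ⊗ₜ[k] (MulOpposite.op b • v)) := by
  change indAction k A B V (MulOpposite.op (a' ⊗ₜ[k] b)) (a ⊗ₜ[k] v) = _
  have h : (Algebra.TensorProduct.opAlgEquiv k k A B).symm (MulOpposite.op (a' ⊗ₜ[k] b)) =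
      MulOpposite.op a' ⊗ₜ[k] MulOpposite.op b := by simp
  change indActionAux k A B V ((Algebra.TensorProduct.opAlgEquiv k k A B).symm
    (MulOpposite.op (a' ⊗ₜ[k] b))) (a ⊗ₜ[k] v) = _
  rw [h]
  rfl

instance : SMulCommClass A (A ⊗[k] B)ᵐᵒᵖ (Ind k A V) where
  smul_comm a r z := ((indAction k A B V r).map_smul a z).symm

end Ind

/-! ## Gorenstein projective modules -/

/-- A finitely generated left `A`-module `G` is Gorenstein projective if there is an exact complex
`P` of finitely generated projective modules, indexed by `ℤ`, such that `Hom_A(P, A)` is exact and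
`G ≅ Ker (d : P¹ → P²)`. -/
def Gproj (A : Type u) [Ring A] : ObjectProperty (ModuleCat.{u} A) := fun G =>
  ∃ P : CochainComplex (ModuleCat.{u} A) ℤ,
    (∀ i, Module.Finite A (P.X i) ∧ Module.Projective A (P.X i)) ∧
    P.Acyclic ∧
    (∀ (i : ℤ) (f : P.X i ⟶ ModuleCat.of A A), P.d (i - 1) i ≫ f = 0 →
      ∃ g : P.X (i + 1) ⟶ ModuleCat.of A A, P.d i (i + 1) ≫ g = f) ∧
    Nonempty (G ≅ Limits.kernel (P.d 1 2))

/-! ## Monomorphism categories -/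

section Mon

variable (k A B : Type u) [Field k] [Ring A] [Algebra k A] [Ring B] [Algebra k B]

/-- `Mon(B, A)`: the finitely generated left modules `X` over `Λ = A ⊗_k B` such that
`Tor_i^Λ(A ⊗ D(S), X) = 0` for all `i ≥ 1` and all simple left `B`-modules `S`. -/
def Mon : ObjectProperty (ModuleCat.{u} (A ⊗[k] B)) := fun X =>
  Module.Finite (A ⊗[k] B) X ∧
  ∀ (S : Type u) [AddCommGroup S] [Module k S] [Module B S] [IsScalarTower k B S]
    [IsSimpleModule B S] (i : ℕ), 1 ≤ i →
    Limits.IsZero (torModule A (A ⊗[k] B) (Ind k A (RightDual k S)) i X)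

/-- `Mon(B, L)` for a full subcategory `L` of left `A`-modules: the modules `X` in `Mon(B, A)` such
that `(A ⊗ V) ⊗_Λ X` lies in `L` for all finitely generated right `B`-modules `V`. -/
def MonIn (L : ObjectProperty (ModuleCat.{u} A)) : ObjectProperty (ModuleCat.{u} (A ⊗[k] B)) :=
  fun X => Mon k A B X ∧
  ∀ (V : Type u) [AddCommGroup V] [Module k V] [Module Bᵐᵒᵖ V] [IsScalarTower k Bᵐᵒᵖ V]
    [Module.Finite Bᵐᵒᵖ V],
    L ((tensorFunctor A (A ⊗[k] B) (Ind k A V)).obj X)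

end Mon

/-! ## Frobenius exact categories -/

section Frobenius

variable {C : Type (u + 1)} [Category.{u} C] [Abelian C] (P : ObjectProperty C)

/-- A conflation of the full subcategory `P` of an abelian category: a short exact sequence all of
whose terms lie in `P`. -/
def Conflation (S : ShortComplex C) : Prop := S.ShortExact ∧ P S.X₁ ∧ P S.X₂ ∧ P S.X₃

/-- `U` is a projective object of the full subcategory `P`: it lies in `P` and `Hom(U, -)` is exact
on conflations. -/
def IsProjObj (U : C) : Prop :=
  P U ∧ ∀ S : ShortComplex C, Conflation P S → ∀ f : U ⟶ S.X₃, ∃ g : U ⟶ S.X₂, g ≫ S.g = f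

/-- `U` is an injective object of the full subcategory `P`: it lies in `P` and `Hom(-, U)` is exact
on conflations. -/
def IsInjObj (U : C) : Prop :=
  P U ∧ ∀ S : ShortComplex C, Conflation P S → ∀ f : S.X₁ ⟶ U, ∃ g : S.X₂ ⟶ U, S.f ≫ g = f

/-- The full subcategory `P` of an abelian category is a Frobenius exact category: it contains zero
and is closed under extensions (hence it is an additive subcategory, and an exact category whose
conflations are the short exact sequences with all terms in `P`), it has enough projective and
enough injective objects, and its projective objects coincide with its injective objects. -/
structure IsFrobeniusExact : Prop where
  containsZero : P.ContainsZero
  closedUnderExtensions : P.IsClosedUnderExtensions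
  enoughProjectives : ∀ X : C, P X →
    ∃ S : ShortComplex C, Conflation P S ∧ IsProjObj P S.X₂ ∧ Nonempty (S.X₃ ≅ X)
  enoughInjectives : ∀ X : C, P X →
    ∃ S : ShortComplex C, Conflation P S ∧ IsInjObj P S.X₂ ∧ Nonempty (S.X₁ ≅ X)
  proj_iff_inj : ∀ U : C, IsProjObj P U ↔ IsInjObj P U

end Frobenius

end

end MonRep

/-! Write Λ = A ⊗ B and T_V X = (A ⊗ V) ⊗_Λ X for a right B-module V. As an abelian group T_V X is V
⊗_B X, so vanishing of Tor against A ⊗ D(S) says that V ⊗_B - stays exact for V = D(S). By k-duality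
this means Ext¹_B(X, S) = 0 for every simple S, and by dévissage X is projective over B. Conversely
B-projectivity makes all syzygy sequences split over B and kills Tor. Thus Mon(B, A) consists of the
finitely generated Λ-modules that are B-projective (`mon_iff`). It is closed under extensions and
kernels of epimorphisms, and every T_V is exact on its conflations.

The functor T_V is left adjoint to N ↦ Hom_k(V, N), and Hom_k(D(B), A) ≅ Λ. If T_V X is Gorenstein
projective, the adjunction turns Ext¹_A(T_V X, A) = 0 into Ext¹_Λ(X, Hom_k(V, A)) = 0. For V = D(B)
this gives Ext¹_Λ(X, Λ) = 0, so projective Λ-modules are injective objects of Mon(B, A-Gproj).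
Enough projectives follows since T_V sends a syzygy sequence to a syzygy sequence over A.

The main point is enough injectives (`MonIn.exists_cosyzygy`). An embedding of T_{D(B)} X into a
projective A-module yields by adjunction a map X → Λⁿ through which every map X → Λ factors. Any V
embeds in a power of D(B), with cokernel W say, and Ext¹_Λ(X, Hom_k(W, A)) = 0 lifts maps X →
Hom_k(V, A) to that power. Hence T_V of the map is again a left approximation by a projective, so it
is injective with Gorenstein projective cokernel. The case V = B gives injectivity of X → Λⁿ itself,
and V = D(S) gives B-projectivity of its cokernel.

For the equivalences: if Mon(B, A) is Frobenius, then Λ is injective in it, and testing this on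
Hom_k(D(B), I) ⊆ Hom_k(D(B), A) for left ideals I is Baer's criterion for A. If A is selfinjective,
every simple module embeds in A, so A is an injective cogenerator, every finitely generated A-module
is Gorenstein projective, and the two categories agree. If they agree, the first part applies. -/

namespace MonRep

/-! ### Short exact sequences of modules. -/

section ShortExact

variable {R : Type*} [Ring R] {X Y Z W : Type*} [AddCommGroup X] [Module R X] [AddCommGroup Y]
  [Module R Y] [AddCommGroup Z] [Module R Z] [AddCommGroup W] [Module R W]

/-- A short exact sequence `0 → X → Y → Z → 0` of modules. -/
structure IsSES (f : X →ₗ[R] Y) (g : Y →ₗ[R] Z) : Prop where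
  inj : Function.Injective f
  surj : Function.Surjective g
  exact : Function.Exact f g

theorem exists_factor_of_surjective {g : Y →ₗ[R] Z} (hg : Function.Surjective g) (f : Y →ₗ[R] W)
    (h : ∀ y, g y = 0 → f y = 0) : ∃ t : Z →ₗ[R] W, ∀ y, t (g y) = f y := by
  refine ⟨(LinearMap.ker g).liftQ f (fun y hy => h y hy) ∘ₗ
    (g.quotKerEquivOfSurjective hg).symm.toLinearMap, fun y => ?_⟩
  have : (g.quotKerEquivOfSurjective hg).symm (g y) = Submodule.Quotient.mk y := by
    rw [LinearEquiv.symm_apply_eq]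
    rfl
  simp only [LinearMap.comp_apply, LinearEquiv.coe_coe, this]
  rfl

theorem exists_lift_of_injective {a : X →ₗ[R] Y} (ha : Function.Injective a) (f : W →ₗ[R] Y)
    (h : ∀ w, ∃ x, a x = f w) : ∃ t : W →ₗ[R] X, ∀ w, a (t w) = f w := by
  refine ⟨(LinearEquiv.ofInjective a ha).symm.toLinearMap ∘ₗ
    f.codRestrict (LinearMap.range a) (fun w => h w), fun w => ?_⟩
  have := LinearEquiv.apply_symm_apply (LinearEquiv.ofInjective a ha)
    (f.codRestrict (LinearMap.range a) (fun w => h w) w)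
  exact congrArg Subtype.val this

theorem IsSES.comp_apply {f : X →ₗ[R] Y} {g : Y →ₗ[R] Z} (s : IsSES f g) (x : X) : g (f x) = 0 :=
  s.exact.apply_apply_eq_zero x

theorem isSES_ker {g : Y →ₗ[R] Z} (hg : Function.Surjective g) :
    IsSES (LinearMap.ker g).subtype g :=
  ⟨Subtype.val_injective, hg, LinearMap.exact_subtype_ker_map g⟩

theorem isSES_range {f : X →ₗ[R] Y} (hf : Function.Injective f) :
    IsSES f (LinearMap.range f).mkQ :=
  ⟨hf, Submodule.mkQ_surjective _, LinearMap.exact_map_mkQ_range f⟩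

theorem isSES_submodule (N : Submodule R Y) : IsSES N.subtype N.mkQ :=
  ⟨Subtype.val_injective, Submodule.mkQ_surjective _, LinearMap.exact_subtype_mkQ N⟩

theorem IsSES.congr_left {f : X →ₗ[R] Y} {g : Y →ₗ[R] Z} (s : IsSES f g) (e : W ≃ₗ[R] X) :
    IsSES (f ∘ₗ e.toLinearMap) g := by
  refine ⟨s.inj.comp e.injective, s.surj, fun y => ?_⟩
  rw [s.exact y]
  constructor
  · rintro ⟨x, rfl⟩
    exact ⟨e.symm x, by simp⟩
  · rintro ⟨x, rfl⟩
    exact ⟨e x, rfl⟩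

theorem IsSES.congr_right {f : X →ₗ[R] Y} {g : Y →ₗ[R] Z} (s : IsSES f g) (e : Z ≃ₗ[R] W) :
    IsSES f (e.toLinearMap ∘ₗ g) := by
  refine ⟨s.inj, e.surjective.comp s.surj, fun y => ?_⟩
  rw [← s.exact y]
  simp

theorem isSES_inl_snd : IsSES (LinearMap.inl R X Y) (LinearMap.snd R X Y) :=
  ⟨LinearMap.inl_injective, LinearMap.snd_surjective, fun y => by
    constructor
    · rintro h
      exact ⟨y.1, Prod.ext rfl h.symm⟩
    · rintro ⟨x, rfl⟩
      rfl⟩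

theorem isSES_inr_fst : IsSES (LinearMap.inr R X Y) (LinearMap.fst R X Y) :=
  ⟨LinearMap.inr_injective, LinearMap.fst_surjective, fun y => by
    constructor
    · rintro h
      exact ⟨y.2, Prod.ext h.symm rfl⟩
    · rintro ⟨x, rfl⟩
      rfl⟩

/-- A short exact sequence with a retraction is a direct sum decomposition. -/
noncomputable def IsSES.prodEquiv {f : X →ₗ[R] Y} {g : Y →ₗ[R] Z} (s : IsSES f g) (r : Y →ₗ[R] X)
    (hr : ∀ x, r (f x) = x) : Y ≃ₗ[R] X × Z :=
  LinearEquiv.ofBijective (r.prod g) (by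
    constructor
    · rw [injective_iff_map_eq_zero]
      intro y hy
      obtain ⟨h1, h2⟩ := Prod.mk.inj hy
      obtain ⟨x, rfl⟩ := (s.exact y).1 h2
      have : x = 0 := (hr x).symm.trans h1
      rw [this, map_zero]
    · rintro ⟨x, z⟩
      obtain ⟨y, rfl⟩ := s.surj z
      refine ⟨y + f (x - r y), Prod.ext ?_ ?_⟩
      · simp [hr]
      · simp [s.comp_apply])

end ShortExact

/-! ### Vanishing of Ext¹ as an extension property. -/

section ExtVanish

variable (R : Type u) [Ring R]

/-- `Ext¹(G, N) = 0`, stated as an extension property for maps into `N`. -/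
def ExtVanish (G N : Type u) [AddCommGroup G] [Module R G] [AddCommGroup N] [Module R N] : Prop :=
  ∀ (Y : Type u) [AddCommGroup Y] [Module R Y] (g : Y →ₗ[R] G), Function.Surjective g →
    ∀ f : LinearMap.ker g →ₗ[R] N, ∃ h : Y →ₗ[R] N, ∀ x : LinearMap.ker g, h x = f x

variable {R}
variable {X Y G G₁ G₃ N N₁ : Type u} [AddCommGroup X] [Module R X] [AddCommGroup Y] [Module R Y]
  [AddCommGroup G] [Module R G] [AddCommGroup G₁] [Module R G₁] [AddCommGroup G₃] [Module R G₃]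
  [AddCommGroup N] [Module R N] [AddCommGroup N₁] [Module R N₁]

theorem ExtVanish.extend (h : ExtVanish R G N) {f : X →ₗ[R] Y} {g : Y →ₗ[R] G} (s : IsSES f g)
    (w : X →ₗ[R] N) : ∃ v : Y →ₗ[R] N, ∀ x, v (f x) = w x := by
  obtain ⟨t, ht⟩ := exists_lift_of_injective s.inj (LinearMap.ker g).subtype
    (fun y => (s.exact y).1 y.2)
  obtain ⟨v, hv⟩ := h Y g s.surj (w ∘ₗ t)
  refine ⟨v, fun x => ?_⟩
  have := hv ⟨f x, s.comp_apply x⟩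
  rw [this]
  have hx : t ⟨f x, s.comp_apply x⟩ = x := s.inj (ht ⟨f x, s.comp_apply x⟩)
  simp [hx]

/-- One projective presentation suffices: it maps to any other surjection Z → G by lifting, and Z is
then the quotient of Y × ker g by the antidiagonal copy of X, so that compatible maps on Y and ker g
glue. -/
theorem ExtVanish.of_presentation [Module.Projective R Y] {i : X →ₗ[R] Y} {p : Y →ₗ[R] G}
    (s : IsSES i p) (h : ∀ w : X →ₗ[R] N, ∃ v : Y →ₗ[R] N, ∀ x, v (i x) = w x) :
    ExtVanish R G N := by
  intro Z _ _ g hg f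
  obtain ⟨l, hl⟩ := Module.projective_lifting_property g p hg
  have hl' : ∀ y, g (l y) = p y := fun y => LinearMap.congr_fun hl y
  let c : X →ₗ[R] LinearMap.ker g := (l ∘ₗ i).codRestrict _ fun x => by
    simp [hl', s.comp_apply]
  obtain ⟨v, hv⟩ := h (f ∘ₗ c)
  have hq : Function.Surjective (l.coprod (LinearMap.ker g).subtype) := fun z => by
    obtain ⟨y, hy⟩ := s.surj (g z)
    exact ⟨(y, ⟨z - l y, by simp [hl', hy]⟩), by simp⟩
  obtain ⟨t, ht⟩ := exists_factor_of_surjective hq (v.coprod f) (by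
    rintro ⟨y, z⟩ hz
    have hz : l y + (z : Z) = 0 := hz
    have hy : p y = 0 := by
      rw [← hl', eq_neg_of_add_eq_zero_left hz, map_neg, LinearMap.mem_ker.1 z.2, neg_zero]
    obtain ⟨x, rfl⟩ := (s.exact y).1 hy
    have hz' : z = - c x := Subtype.ext (eq_neg_of_add_eq_zero_right hz)
    simp [hv, hz'])
  exact ⟨t, fun x => by simpa using ht (0, x)⟩

/-- The map is extended in two stages: from ker g to the preimage of G₁, and from there to all of Y.
-/
theorem ExtVanish.extension {a : G₁ →ₗ[R] G} {b : G →ₗ[R] G₃} (s : IsSES a b)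
    (h₁ : ExtVanish R G₁ N) (h₃ : ExtVanish R G₃ N) : ExtVanish R G N := by
  intro Y _ _ g hg f
  have hle : LinearMap.ker g ≤ LinearMap.ker (b ∘ₗ g) := LinearMap.ker_le_ker_comp g b
  obtain ⟨t, ht⟩ := exists_lift_of_injective s.inj (g ∘ₗ (LinearMap.ker (b ∘ₗ g)).subtype)
    (fun y => (s.exact _).1 y.2)
  have s₁ : IsSES (Submodule.inclusion hle) t := by
    refine ⟨Submodule.inclusion_injective hle, fun x => ?_, fun y => ?_⟩
    · obtain ⟨y, hy⟩ := hg (a x)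
      refine ⟨⟨y, ?_⟩, s.inj ?_⟩
      · simp [hy, s.comp_apply]
      · simp [ht, hy]
    · constructor
      · intro hy
        have := ht y
        rw [hy, map_zero] at this
        exact ⟨⟨y, this.symm⟩, rfl⟩
      · rintro ⟨x, rfl⟩
        exact s.inj (by simp [ht])
  obtain ⟨f₁, hf₁⟩ := h₁.extend s₁ f
  obtain ⟨f₂, hf₂⟩ := h₃.extend (isSES_ker (s.surj.comp hg : Function.Surjective (b ∘ₗ g))) f₁
  refine ⟨f₂, fun x => ?_⟩
  rw [← hf₁, ← hf₂]
  rfl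

/-- The given surjection onto G₁ is pulled back along r to one onto G; i induces a map from Y back
into the pullback. -/
theorem ExtVanish.retract (h : ExtVanish R G N) {i : G₁ →ₗ[R] G} {r : G →ₗ[R] G₁}
    (hr : ∀ x, r (i x) = x) : ExtVanish R G₁ N := by
  intro Y _ _ g hg f
  let E : Submodule R (Y × G) :=
    LinearMap.ker (g ∘ₗ LinearMap.fst R Y G - r ∘ₗ LinearMap.snd R Y G)
  have hE : ∀ y x, (y, x) ∈ E ↔ g y = r x := fun y x => by simp [E, sub_eq_zero]
  let a : LinearMap.ker g →ₗ[R] E :=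
    (LinearMap.inl R Y G ∘ₗ (LinearMap.ker g).subtype).codRestrict E fun y => by
      simp [hE]
  let b : E →ₗ[R] G := LinearMap.snd R Y G ∘ₗ E.subtype
  have s : IsSES a b := by
    refine ⟨fun x y hxy => ?_, fun x => ?_, fun y => ?_⟩
    · exact Subtype.ext (congrArg (fun z : E => z.1.1) hxy)
    · obtain ⟨y, hy⟩ := hg (r x)
      exact ⟨⟨(y, x), (hE _ _).2 hy⟩, rfl⟩
    · constructor
      · intro hy
        obtain ⟨⟨y, x⟩, hyx⟩ := y
        have hx : x = 0 := hy
        subst hx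
        exact ⟨⟨y, by simpa using (hE _ _).1 hyx⟩, rfl⟩
      · rintro ⟨x, rfl⟩
        rfl
  obtain ⟨v, hv⟩ := h.extend s f
  let c : Y →ₗ[R] E := (LinearMap.id.prod (i ∘ₗ g)).codRestrict E fun y => by
    simp [hE, hr]
  refine ⟨v ∘ₗ c, fun x => ?_⟩
  rw [← hv]
  exact congrArg v (Subtype.ext (Prod.ext rfl (show i (g x) = (0 : G) by simp)))

theorem ExtVanish.congr (h : ExtVanish R G N) (e : G ≃ₗ[R] G₁) : ExtVanish R G₁ N :=
  h.retract (i := e.symm.toLinearMap) (r := e.toLinearMap) (by simp)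

theorem ExtVanish.of_projective [Module.Projective R G] : ExtVanish R G N :=
  ExtVanish.of_presentation (X := PUnit) (i := 0) (p := LinearMap.id)
    ⟨fun _ _ _ => rfl, Function.surjective_id, fun y => by simp [eq_comm]⟩
    (fun w => ⟨0, fun x => by rw [Subsingleton.elim x 0, map_zero, map_zero, map_zero]⟩)

theorem ExtVanish.retract_right (h : ExtVanish R G N) {i : N₁ →ₗ[R] N} {r : N →ₗ[R] N₁}
    (hr : ∀ x, r (i x) = x) : ExtVanish R G N₁ := by
  intro Y _ _ g hg f
  obtain ⟨v, hv⟩ := h Y g hg (i ∘ₗ f)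
  exact ⟨r ∘ₗ v, fun x => by simp [hv, hr]⟩

theorem ExtVanish.pi (h : ExtVanish R G N) (ι : Type) : ExtVanish R G (ι → N) := by
  intro Y _ _ g hg f
  choose v hv using fun j => h Y g hg (LinearMap.proj j ∘ₗ f)
  exact ⟨LinearMap.pi v, fun x => by ext j; simp [hv]⟩

theorem exists_retract_pi [Module.Finite R N] [Module.Projective R N] :
    ∃ (n : ℕ) (i : N →ₗ[R] (Fin n → R)) (r : (Fin n → R) →ₗ[R] N), ∀ x, r (i x) = x := by
  obtain ⟨n, r, hr⟩ := Module.Finite.exists_fin' R N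
  obtain ⟨i, hi⟩ := r.exists_rightInverse_of_surjective (LinearMap.range_eq_top.2 hr)
  exact ⟨n, i, r, fun x => LinearMap.congr_fun hi x⟩

/-- The pullback of N → X ← G is an extension of G by N₁. It splits, and a splitting is a lift. -/
theorem ExtVanish.lift (h : ExtVanish R G N₁) {i : N₁ →ₗ[R] N} {p : N →ₗ[R] X} (s : IsSES i p)
    (w : G →ₗ[R] X) : ∃ v : G →ₗ[R] N, ∀ x, p (v x) = w x := by
  let E : Submodule R (N × G) :=
    LinearMap.ker (p ∘ₗ LinearMap.fst R N G - w ∘ₗ LinearMap.snd R N G)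
  have hE : ∀ y x, (y, x) ∈ E ↔ p y = w x := fun y x => by simp [E, sub_eq_zero]
  let a : N₁ →ₗ[R] E := (LinearMap.inl R N G ∘ₗ i).codRestrict E fun y => by
      simp [hE, s.comp_apply]
  let b : E →ₗ[R] G := LinearMap.snd R N G ∘ₗ E.subtype
  have s' : IsSES a b := by
    refine ⟨fun x y hxy => ?_, fun x => ?_, fun y => ?_⟩
    · exact s.inj (congrArg (fun z : E => z.1.1) hxy)
    · obtain ⟨y, hy⟩ := s.surj (w x)
      exact ⟨⟨(y, x), (hE _ _).2 hy⟩, rfl⟩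
    · constructor
      · intro hy
        obtain ⟨⟨y, x⟩, hyx⟩ := y
        have hx : x = 0 := hy
        subst hx
        obtain ⟨z, rfl⟩ := (s.exact y).1 (by simpa using (hE _ _).1 hyx)
        exact ⟨z, rfl⟩
      · rintro ⟨x, rfl⟩
        rfl
  obtain ⟨v, hv⟩ := h.extend s' LinearMap.id
  obtain ⟨t, ht⟩ := exists_factor_of_surjective s'.surj
    (LinearMap.fst R N G ∘ₗ E.subtype - i ∘ₗ v) (fun y hy => by
      obtain ⟨z, rfl⟩ := (s'.exact y).1 hy
      rw [LinearMap.sub_apply, LinearMap.comp_apply i, hv]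
      exact sub_self (i z))
  refine ⟨t, fun x => ?_⟩
  obtain ⟨y, rfl⟩ := s'.surj x
  rw [ht]
  simpa [s.comp_apply, b] using (hE _ _).1 y.2

/-- On a free presentation of G: extend the image of f in X, lift the extension to N by freeness,
and correct the difference, which lands in N₁. -/
theorem ExtVanish.extension_right {i : N₁ →ₗ[R] N} {p : N →ₗ[R] X} (s : IsSES i p)
    (h₁ : ExtVanish R G N₁) (h₃ : ExtVanish R G X) : ExtVanish R G N := by
  set p₀ : (G →₀ R) →ₗ[R] G := Finsupp.linearCombination R id
  have hp₀ : Function.Surjective p₀ := Finsupp.linearCombination_id_surjective R G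
  refine ExtVanish.of_presentation (isSES_ker hp₀) fun f => ?_
  obtain ⟨h, hh⟩ := h₃.extend (isSES_ker hp₀) (p ∘ₗ f)
  obtain ⟨l, hl⟩ := Module.projective_lifting_property p h s.surj
  obtain ⟨c, hc⟩ := exists_lift_of_injective (W := LinearMap.ker p₀) s.inj
    (f - l ∘ₗ (LinearMap.ker p₀).subtype)
    (fun x => (s.exact _).1 (by
      have h1 := LinearMap.congr_fun hl x
      have h2 := hh x
      simp only [LinearMap.comp_apply] at h1 h2
      simp [h1, ← h2]))
  obtain ⟨e, he⟩ := h₁.extend (isSES_ker hp₀) c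
  refine ⟨l + i ∘ₗ e, fun x => ?_⟩
  have h3 : e ((LinearMap.ker p₀).subtype x) = c x := he x
  rw [LinearMap.add_apply, LinearMap.comp_apply i, h3, hc]
  simp

theorem ExtVanish.of_isFiniteLength
    (h : ∀ (S : Type u) [AddCommGroup S] [Module R S] [IsSimpleModule R S], ExtVanish R G S)
    (hN : IsFiniteLength R N) : ExtVanish R G N := by
  induction hN with
  | of_subsingleton => exact fun Y _ _ g hg f => ⟨0, fun x => Subsingleton.elim _ _⟩
  | @of_simple_quotient M _ _ N _ _ ih => exact ih.extension_right (isSES_submodule N) (h _)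

/-- The kernel of a finite free cover of G is finitely generated, so the identity of G lifts along
the cover. -/
theorem projective_of_extVanish [IsNoetherianRing R] [Module.Finite R G]
    (h : ∀ (N : Type u) [AddCommGroup N] [Module R N] [Module.Finite R N], ExtVanish R G N) :
    Module.Projective R G := by
  obtain ⟨n, p, hp⟩ := Module.Finite.exists_fin' R G
  obtain ⟨v, hv⟩ := (h (LinearMap.ker p)).lift (isSES_ker hp) LinearMap.id
  exact Module.Projective.of_split v p (LinearMap.ext hv)

end ExtVanish

/-! ### Gorenstein projective modules. -/

section Gproj

/-- Dependent choice in both directions, used to splice short exact sequences into a complex indexed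
by ℤ. -/
theorem exists_int_sequence {α : Type*} {p : α → Prop} {r : α → α → Prop}
    (hnext : ∀ a, p a → ∃ b, p b ∧ r a b) (hprev : ∀ a, p a → ∃ b, p b ∧ r b a) (a : α) (ha : p a) :
    ∃ s : ℤ → α, s 1 = a ∧ (∀ n, p (s n)) ∧ ∀ n, r (s n) (s (n + 1)) := by
  choose f hf using fun x : {x // p x} => hnext x.1 x.2
  choose g hg using fun x : {x // p x} => hprev x.1 x.2
  let up : ℕ → {x // p x} := fun n => Nat.rec ⟨a, ha⟩ (fun _ x => ⟨f x, (hf x).1⟩) n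
  let down : ℕ → {x // p x} := fun n => Nat.rec ⟨a, ha⟩ (fun _ x => ⟨g x, (hg x).1⟩) n
  let t : ℤ → {x // p x} := fun n => match n with
    | Int.ofNat n => up n
    | Int.negSucc n => down (n + 1)
  have ht : ∀ n, r (t n) (t (n + 1)) := by
    rintro (n | n)
    · exact (hf (up n)).2
    · cases n with
      | zero => exact (hg (down 0)).2
      | succ n => 
        have : Int.negSucc (n + 1) + 1 = Int.negSucc n := by omega
        rw [this]
        exact (hg (down (n + 1))).2
  -- The shift puts a at index 1, because a Gorenstein projective module is defined as the kernel of
  -- d¹.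
  refine ⟨fun n => t (n - 1), rfl, fun n => (t _).2, fun n => ?_⟩
  have := ht (n - 1)
  rwa [show n - 1 + 1 = n + 1 - 1 by ring] at this

variable {A : Type u} [Ring A]

variable (A) in
/-- There is a short exact sequence `0 → G → P → G' → 0` with `P` finitely generated projective. -/
def IsCosyzygy (G G' : Type u) [AddCommGroup G] [Module A G] [AddCommGroup G'] [Module A G'] :
    Prop :=
  ∃ (P : ModuleCat.{u} A) (i : G →ₗ[A] P) (p : P →ₗ[A] G'),
    Module.Finite A P ∧ Module.Projective A P ∧ IsSES i p

/-- A class of modules each member of which has vanishing `Ext¹` into `A`, and is both a syzygy and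
a cosyzygy of a member of the class. -/
def IsGorensteinClass (L : ObjectProperty (ModuleCat.{u} A)) : Prop :=
  ∀ G : ModuleCat.{u} A, L G → ExtVanish A G A ∧
    (∃ G' : ModuleCat.{u} A, L G' ∧ IsCosyzygy A G G') ∧
    (∃ G' : ModuleCat.{u} A, L G' ∧ IsCosyzygy A G' G)

/-- The Gorenstein projective modules contain every Gorenstein class. -/
theorem IsGorensteinClass.le_gproj {L : ObjectProperty (ModuleCat.{u} A)}
    (hL : IsGorensteinClass L) {G : ModuleCat.{u} A} (hG : L G) : Gproj A G := by
  obtain ⟨s, rfl, hs, hr⟩ := exists_int_sequence (p := L) (r := fun G G' => IsCosyzygy A G G')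
    (fun G h => (hL G h).2.1) (fun G h => (hL G h).2.2) G hG
  choose P i p hfin hproj hses using hr
  -- Splicing the sequences 0 → s n → P n → s (n + 1) → 0 makes s n the kernel of the n-th
  -- differential.
  let d : ∀ n, P n ⟶ P (n + 1) := fun n => ModuleCat.ofHom (i (n + 1) ∘ₗ p n)
  have hd : ∀ n, d n ≫ d (n + 1) = 0 := fun n => by
    ext x
    simp [d, (hses (n + 1)).comp_apply]
  have hexact : ∀ n (y : P (n + 1)), p (n + 1) y = 0 → ∃ x, d n x = y := by
    intro n y hy
    obtain ⟨z, rfl⟩ := ((hses (n + 1)).exact y).1 hy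
    obtain ⟨x, rfl⟩ := (hses n).surj z
    exact ⟨x, rfl⟩
  have hexact' : ∀ n y, d (n + 1) y = 0 → ∃ x, d n x = y := by
    intro n y hy
    refine hexact n y ((hses (n + 1 + 1)).inj ?_)
    rw [map_zero]
    exact hy
  have hC : ∀ n (x : P n), ((CochainComplex.of (fun n => P n) d hd).d n (n + 1)).hom x =
      i (n + 1) (p n x) := fun n x =>
    ConcreteCategory.congr_hom (CochainComplex.of_d (fun n => P n) d n) x
  refine ⟨CochainComplex.of (fun n => P n) d hd, fun n => ⟨hfin n, hproj n⟩, fun n => ?_,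
    fun n f hf => ?_, ?_⟩
  · obtain ⟨n, rfl⟩ : ∃ m, n = m + 1 := ⟨n - 1, by ring⟩
    rw [HomologicalComplex.exactAt_iff' _ n (n + 1) (n + 1 + 1) (by simp) (by simp),
      ShortComplex.moduleCat_exact_iff]
    intro y hy
    obtain ⟨x, hx⟩ := hexact' n y ((hC (n + 1) y).symm.trans hy)
    exact ⟨x, (hC n x).trans hx⟩
  · obtain ⟨n, rfl⟩ : ∃ m, n = m + 1 := ⟨n - 1, by ring⟩
    rw [show n + 1 - 1 = n by ring] at hf
    -- The functional vanishes on s (n + 1), so it descends to s (n + 2). It extends to the next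
    -- projective because Ext¹(s (n + 3), A) = 0.
    have hf' : ∀ x, f.hom (i (n + 1) x) = 0 := fun x => by
      obtain ⟨y, rfl⟩ := (hses n).surj x
      have := ConcreteCategory.congr_hom hf y
      rw [← hC]
      exact this
    obtain ⟨t, ht⟩ := exists_factor_of_surjective (hses (n + 1)).surj f.hom (fun y hy => by
      obtain ⟨z, rfl⟩ := ((hses (n + 1)).exact y).1 hy
      exact hf' z)
    obtain ⟨g, hg⟩ := (hL _ (hs _)).1.extend (hses (n + 1 + 1)) t
    refine ⟨ModuleCat.ofHom g, ?_⟩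
    ext x
    change g (((CochainComplex.of (fun n => P n) d hd).d (n + 1) (n + 1 + 1)).hom x) = f.hom x
    rw [hC, hg, ht]
  · refine ⟨LinearEquiv.toModuleIso ?_ ≪≫ (ModuleCat.kernelIsoKer _).symm⟩
    refine LinearEquiv.ofBijective (LinearMap.codRestrict _ (i 1) fun x => ?_) ⟨?_, ?_⟩
    · refine (hC 1 (i 1 x)).trans ?_
      rw [(hses 1).comp_apply, map_zero]
    · intro x y hxy
      exact (hses 1).inj (congrArg Subtype.val hxy)
    · rintro ⟨y, hy⟩
      have hy : i (1 + 1) (p 1 y) = 0 := (hC 1 y).symm.trans hy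
      obtain ⟨x, hx⟩ := ((hses 1).exact y).1 ((hses (1 + 1)).inj (hy.trans (map_zero _).symm))
      exact ⟨x, Subtype.ext hx⟩

theorem Gproj.congr {G G' : ModuleCat.{u} A} (h : Gproj A G) (e : G ≃ₗ[A] G') : Gproj A G' := by
  obtain ⟨P, h1, h2, h3, ⟨h4⟩⟩ := h
  exact ⟨P, h1, h2, h3, ⟨e.toModuleIso.symm ≪≫ h4⟩⟩

/-- The cycles of a totally acyclic complex are syzygies and cosyzygies of each other, and exactness
of the dual complex is the vanishing of Ext¹ into A. -/
theorem isGorensteinClass_ker (P : CochainComplex (ModuleCat.{u} A) ℤ)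
    (hP : ∀ i, Module.Finite A (P.X i) ∧ Module.Projective A (P.X i)) (hac : P.Acyclic)
    (hdual : ∀ (i : ℤ) (f : P.X i ⟶ ModuleCat.of A A), P.d (i - 1) i ≫ f = 0 →
      ∃ g : P.X (i + 1) ⟶ ModuleCat.of A A, P.d i (i + 1) ≫ g = f) :
    IsGorensteinClass fun G : ModuleCat.{u} A =>
      ∃ n : ℤ, Nonempty (G ≃ₗ[A] LinearMap.ker (P.d n (n + 1)).hom) := by
  have hdd : ∀ n (x : P.X n), (P.d (n + 1) (n + 1 + 1)).hom ((P.d n (n + 1)).hom x) = 0 :=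
    fun n x => ConcreteCategory.congr_hom (P.d_comp_d n (n + 1) (n + 1 + 1)) x
  have hex : ∀ n (y : P.X (n + 1)), (P.d (n + 1) (n + 1 + 1)).hom y = 0 →
      ∃ x, (P.d n (n + 1)).hom x = y := fun n y hy => by
    have := hac (n + 1)
    rw [HomologicalComplex.exactAt_iff' _ n (n + 1) (n + 1 + 1) (by simp) (by simp),
      ShortComplex.moduleCat_exact_iff] at this
    exact this y hy
  let q : ∀ n, P.X n →ₗ[A] LinearMap.ker (P.d (n + 1) (n + 1 + 1)).hom := fun n =>
    (P.d n (n + 1)).hom.codRestrict _ (hdd n)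
  have hses : ∀ n, IsSES (LinearMap.ker (P.d n (n + 1)).hom).subtype (q n) := fun n => by
    refine ⟨Subtype.val_injective, ?_, fun y => ?_⟩
    · rintro ⟨y, hy⟩
      obtain ⟨x, hx⟩ := hex n y hy
      exact ⟨x, Subtype.ext hx⟩
    · constructor
      · intro hy
        exact ⟨⟨y, congrArg Subtype.val hy⟩, rfl⟩
      · rintro ⟨x, rfl⟩
        exact Subtype.ext x.2
  rintro G ⟨n, ⟨e⟩⟩
  have s := (hses n).congr_left e
  refine ⟨?_, ⟨ModuleCat.of A _, ⟨n + 1, ⟨LinearEquiv.refl _ _⟩⟩, P.X n, _, _, (hP n).1,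
    (hP n).2, s⟩,
    ?_⟩
  · obtain ⟨m, rfl⟩ : ∃ m, n = m + 1 := ⟨n - 1, by ring⟩
    have := (hP m).2
    refine (ExtVanish.of_presentation (hses m) fun w => ?_).congr e.symm
    obtain ⟨m, rfl⟩ : ∃ l, m = l + 1 := ⟨m - 1, by ring⟩
    obtain ⟨g, hg⟩ := hdual m (ModuleCat.ofHom (w ∘ₗ q m)) (by
      ext x
      have : q m ((P.d (m - 1) m).hom x) = 0 := Subtype.ext
        (ConcreteCategory.congr_hom (P.d_comp_d (m - 1) m (m + 1)) x)
      change w (q m ((P.d (m - 1) m).hom x)) = 0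
      rw [this, map_zero])
    refine ⟨g.hom, fun x => ?_⟩
    obtain ⟨y, rfl⟩ := (hses m).surj x
    exact ConcreteCategory.congr_hom hg y
  · obtain ⟨m, rfl⟩ : ∃ m, n = m + 1 := ⟨n - 1, by ring⟩
    exact ⟨ModuleCat.of A _, ⟨m, ⟨LinearEquiv.refl _ _⟩⟩, P.X m, _, _, (hP m).1, (hP m).2,
      (hses m).congr_right e.symm⟩

/-- With `IsGorensteinClass.le_gproj` this makes `Gproj A` the largest Gorenstein class. The closure
properties below are proved coinductively, by exhibiting a Gorenstein class, so no complex has to be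
built again. -/
theorem isGorensteinClass_gproj : IsGorensteinClass (Gproj A) := by
  rintro G ⟨P, hP, hac, hdual, ⟨e⟩⟩
  have hL := isGorensteinClass_ker P hP hac hdual
  obtain ⟨h1, ⟨G₁, hG₁, h₁⟩, ⟨G₂, hG₂, h₂⟩⟩ := hL G
    ⟨1, ⟨(e ≪≫ ModuleCat.kernelIsoKer _).toLinearEquiv⟩⟩
  exact ⟨h1, ⟨G₁, hL.le_gproj hG₁, h₁⟩, ⟨G₂, hL.le_gproj hG₂, h₂⟩⟩

theorem Gproj.extVanish {G : ModuleCat.{u} A} (h : Gproj A G) : ExtVanish A G A :=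
  (isGorensteinClass_gproj G h).1

theorem ExtVanish.finite_projective {G P : Type u} [AddCommGroup G] [Module A G] [AddCommGroup P]
    [Module A P] [Module.Finite A P] [Module.Projective A P] (h : ExtVanish A G A) :
    ExtVanish A G P := by
  obtain ⟨n, i, r, hr⟩ := exists_retract_pi (R := A) (N := P)
  exact (h.pi (Fin n)).retract_right hr

theorem Gproj.of_projective {P : ModuleCat.{u} A} [Module.Finite A P] [Module.Projective A P] :
    Gproj A P := by
  have : IsGorensteinClass fun P : ModuleCat.{u} A =>
      Module.Finite A P ∧ Module.Projective A P := by
    rintro P ⟨h1, h2⟩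
    refine ⟨ExtVanish.of_projective, ⟨ModuleCat.of A PUnit, ⟨inferInstance, inferInstance⟩,
      P, LinearMap.id, 0, h1, h2, Function.injective_id, fun _ => ⟨0, rfl⟩, fun y => by simp⟩,
      ⟨ModuleCat.of A PUnit, ⟨inferInstance, inferInstance⟩,
      P, 0, LinearMap.id, h1, h2, fun _ _ _ => rfl, Function.surjective_id,
      fun y => by simp [eq_comm]⟩⟩
  exact this.le_gproj ⟨inferInstance, inferInstance⟩

/-! ### Kernels and cokernels for the horseshoe lemma. -/

section Horseshoe

variable {G₁ G₂ G₃ P₁ P₂ P₃ C₁ C₂ C₃ : Type u} [AddCommGroup G₁] [Module A G₁] [AddCommGroup G₂]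
  [Module A G₂] [AddCommGroup G₃] [Module A G₃] [AddCommGroup P₁] [Module A P₁] [AddCommGroup P₂]
  [Module A P₂] [AddCommGroup P₃] [Module A P₃] [AddCommGroup C₁] [Module A C₁]
  [AddCommGroup C₃] [Module A C₃]

/-- The kernels of a surjection between short exact sequences form a short exact sequence. -/
theorem IsSES.exists_ker {a : G₁ →ₗ[A] G₂} {b : G₂ →ₗ[A] G₃} (s : IsSES a b)
    {a' : P₁ →ₗ[A] P₂} {b' : P₂ →ₗ[A] P₃} (s' : IsSES a' b')
    {f₁ : P₁ →ₗ[A] G₁} {f₂ : P₂ →ₗ[A] G₂} {f₃ : P₃ →ₗ[A] G₃}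
    (h₁ : Function.Surjective f₁)
    (ha : ∀ x, f₂ (a' x) = a (f₁ x)) (hb : ∀ x, f₃ (b' x) = b (f₂ x)) :
    ∃ (c : LinearMap.ker f₁ →ₗ[A] LinearMap.ker f₂) (d : LinearMap.ker f₂ →ₗ[A] LinearMap.ker f₃),
      IsSES c d := by
  refine ⟨(a' ∘ₗ (LinearMap.ker f₁).subtype).codRestrict _ fun x => by simp [ha],
    (b' ∘ₗ (LinearMap.ker f₂).subtype).codRestrict _ fun x => by simp [hb], ?_, ?_, ?_⟩
  · exact fun x y hxy => Subtype.ext (s'.inj (congrArg Subtype.val hxy))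
  · rintro ⟨x, hx⟩
    obtain ⟨y, rfl⟩ := s'.surj x
    obtain ⟨z, hz⟩ := (s.exact (f₂ y)).1 (by rw [← hb]; exact hx)
    obtain ⟨w, rfl⟩ := h₁ z
    exact ⟨⟨y - a' w, by simp [ha, hz]⟩, Subtype.ext
      (show b' (y - a' w) = b' y by rw [map_sub, s'.comp_apply, sub_zero])⟩
  · rintro ⟨x, hx⟩
    constructor
    · intro h
      obtain ⟨y, rfl⟩ := (s'.exact x).1 (congrArg Subtype.val h)
      refine ⟨⟨y, s.inj ?_⟩, rfl⟩
      rw [← ha, map_zero]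
      exact hx
    · rintro ⟨y, hy⟩
      have hy : a' y = x := congrArg Subtype.val hy
      subst hy
      exact Subtype.ext (s'.comp_apply _)

/-- The kernel of q ∘ p is the preimage under p of the submodule P₁ = ker q. -/
theorem IsSES.exists_ker_comp {i : G₁ →ₗ[A] G₂} {p : G₂ →ₗ[A] G₃} (s : IsSES i p)
    {j : P₁ →ₗ[A] G₃} {q : G₃ →ₗ[A] P₃} (t : IsSES j q) :
    ∃ (c : G₁ →ₗ[A] LinearMap.ker (q ∘ₗ p)) (d : LinearMap.ker (q ∘ₗ p) →ₗ[A] P₁),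
      IsSES c d := by
  obtain ⟨d, hd⟩ := exists_lift_of_injective t.inj (p ∘ₗ (LinearMap.ker (q ∘ₗ p)).subtype)
    (fun x => (t.exact _).1 x.2)
  refine ⟨i.codRestrict _ fun x => by simp [s.comp_apply], d, fun x y hxy => ?_, fun x => ?_,
    fun x => ?_⟩
  · exact s.inj (congrArg Subtype.val hxy)
  · obtain ⟨y, hy⟩ := s.surj (j x)
    exact ⟨⟨y, by simp [hy, t.comp_apply]⟩, t.inj ((hd _).trans hy)⟩
  · constructor
    · intro hx
      obtain ⟨y, hy⟩ := (s.exact (x : G₂)).1 (by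
        have := hd x
        rw [hx, map_zero] at this
        exact this.symm)
      exact ⟨y, Subtype.ext hy⟩
    · rintro ⟨y, rfl⟩
      refine t.inj ?_
      exact ((hd _).trans (s.comp_apply y)).trans (map_zero j).symm

/-- The cokernels of an injection between short exact sequences form a short exact sequence. -/
theorem IsSES.exists_coker {a : G₁ →ₗ[A] G₂} {b : G₂ →ₗ[A] G₃} (s : IsSES a b)
    {a' : P₁ →ₗ[A] P₂} {b' : P₂ →ₗ[A] P₃} (s' : IsSES a' b')
    {f₁ : G₁ →ₗ[A] P₁} {f₂ : G₂ →ₗ[A] P₂} {f₃ : G₃ →ₗ[A] P₃}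
    (ha : ∀ x, f₂ (a x) = a' (f₁ x)) (hb : ∀ x, f₃ (b x) = b' (f₂ x))
    {q₁ : P₁ →ₗ[A] C₁} {q₃ : P₃ →ₗ[A] C₃} (t₁ : IsSES f₁ q₁) (t₃ : IsSES f₃ q₃) :
    IsSES f₂ (LinearMap.range f₂).mkQ ∧
    ∃ (c : C₁ →ₗ[A] P₂ ⧸ LinearMap.range f₂) (d : (P₂ ⧸ LinearMap.range f₂) →ₗ[A] C₃),
      IsSES c d := by
  have hinj : Function.Injective f₂ := by
    rw [injective_iff_map_eq_zero]
    intro x hx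
    obtain ⟨y, rfl⟩ := (s.exact x).1 (t₃.inj (by rw [hb, hx, map_zero, map_zero]))
    have : y = 0 := t₁.inj (s'.inj (by rw [← ha, hx, map_zero, map_zero]))
    rw [this, map_zero]
  have t₂ := isSES_range hinj
  refine ⟨t₂, ?_⟩
  obtain ⟨c, hc⟩ := exists_factor_of_surjective t₁.surj ((LinearMap.range f₂).mkQ ∘ₗ a')
    (fun y hy => by
      obtain ⟨x, rfl⟩ := (t₁.exact y).1 hy
      rw [LinearMap.comp_apply, ← ha, t₂.comp_apply])
  obtain ⟨d, hd⟩ := exists_factor_of_surjective t₂.surj (q₃ ∘ₗ b')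
    (fun y hy => by
      obtain ⟨x, rfl⟩ := (t₂.exact y).1 hy
      rw [LinearMap.comp_apply, ← hb, t₃.comp_apply])
  refine ⟨c, d, ?_, fun z => ?_, fun z => ?_⟩
  · rw [injective_iff_map_eq_zero]
    intro x hx
    obtain ⟨y, rfl⟩ := t₁.surj x
    rw [hc] at hx
    obtain ⟨z, hz⟩ := (t₂.exact _).1 hx
    obtain ⟨w, rfl⟩ := (s.exact z).1 (t₃.inj (by rw [hb, hz, s'.comp_apply, map_zero]))
    rw [ha] at hz
    rw [← s'.inj hz, t₁.comp_apply]
  · obtain ⟨y, rfl⟩ := t₃.surj z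
    obtain ⟨x, rfl⟩ := s'.surj y
    exact ⟨_, hd x⟩
  · constructor
    · intro hz
      obtain ⟨y, rfl⟩ := t₂.surj z
      rw [hd] at hz
      obtain ⟨x, hx⟩ := (t₃.exact _).1 hz
      obtain ⟨w, rfl⟩ := s.surj x
      obtain ⟨v, hv⟩ := (s'.exact (y - f₂ w)).1 (by rw [map_sub, ← hb, hx, sub_self])
      refine ⟨q₁ v, ?_⟩
      rw [hc, LinearMap.comp_apply, hv, map_sub, t₂.comp_apply, sub_zero]
    · rintro ⟨x, rfl⟩
      obtain ⟨y, rfl⟩ := t₁.surj x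
      rw [hc, LinearMap.comp_apply, hd, LinearMap.comp_apply, s'.comp_apply, map_zero]

end Horseshoe

/-- The extensions of Gorenstein projectives form a Gorenstein class by the horseshoe lemma on both
sides. On the cosyzygy side, G₁ → P₁ extends to G because Ext¹(G₃, P₁) = 0. -/
theorem Gproj.extension {G₁ G G₃ : ModuleCat.{u} A} {a : G₁ →ₗ[A] G} {b : G →ₗ[A] G₃}
    (s : IsSES a b) (h₁ : Gproj A G₁) (h₃ : Gproj A G₃) : Gproj A G := by
  have key : IsGorensteinClass fun G : ModuleCat.{u} A => ∃ (G₁ G₃ : ModuleCat.{u} A)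
      (a : G₁ →ₗ[A] G) (b : G →ₗ[A] G₃), IsSES a b ∧ Gproj A G₁ ∧ Gproj A G₃ := by
    rintro G ⟨G₁, G₃, a, b, s, h₁, h₃⟩
    refine ⟨h₁.extVanish.extension s h₃.extVanish, ?_, ?_⟩
    · obtain ⟨C₁, hC₁, P₁, i₁, p₁, _, _, t₁⟩ := (isGorensteinClass_gproj G₁ h₁).2.1
      obtain ⟨C₃, hC₃, P₃, i₃, p₃, _, _, t₃⟩ := (isGorensteinClass_gproj G₃ h₃).2.1
      obtain ⟨j, hj⟩ := h₃.extVanish.finite_projective.extend s i₁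
      obtain ⟨t₂, c, d, s'⟩ := s.exists_coker (isSES_inl_snd (X := P₁) (Y := P₃))
        (f₁ := i₁) (f₂ := j.prod (i₃ ∘ₗ b)) (f₃ := i₃)
        (fun x => Prod.ext (hj x) (by simp [s.comp_apply])) (fun x => rfl) t₁ t₃
      exact ⟨ModuleCat.of A _, ⟨C₁, C₃, c, d, s', hC₁, hC₃⟩, ModuleCat.of A (P₁ × P₃), _, _,
        inferInstanceAs (Module.Finite A (P₁ × P₃)),
        inferInstanceAs (Module.Projective A (P₁ × P₃)), t₂⟩
    · obtain ⟨C₁, hC₁, P₁, i₁, p₁, _, _, t₁⟩ := (isGorensteinClass_gproj G₁ h₁).2.2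
      obtain ⟨C₃, hC₃, P₃, i₃, p₃, _, _, t₃⟩ := (isGorensteinClass_gproj G₃ h₃).2.2
      obtain ⟨j, hj⟩ := Module.projective_lifting_property b p₃ s.surj
      have hj : ∀ x, b (j x) = p₃ x := fun x => LinearMap.congr_fun hj x
      obtain ⟨c, d, s'⟩ := s.exists_ker (isSES_inl_snd (X := P₁) (Y := P₃))
        (f₁ := p₁) (f₂ := (a ∘ₗ p₁).coprod j) (f₃ := p₃) t₁.surj
        (fun x => by simp) (fun x => by simp [s.comp_apply, hj])
      have hsurj : Function.Surjective ((a ∘ₗ p₁).coprod j) := fun x => by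
        obtain ⟨y, hy⟩ := t₃.surj (b x)
        obtain ⟨z, hz⟩ := (s.exact (x - j y)).1 (by rw [map_sub, hj, hy, sub_self])
        obtain ⟨w, rfl⟩ := t₁.surj z
        exact ⟨(w, y), by simp [hz]⟩
      exact ⟨ModuleCat.of A _, ⟨ModuleCat.of A _, ModuleCat.of A _, c, d, s',
          hC₁.congr ((LinearEquiv.ofInjective i₁ t₁.inj).trans
            (LinearEquiv.ofEq _ _ (LinearMap.exact_iff.1 t₁.exact).symm)),
          hC₃.congr ((LinearEquiv.ofInjective i₃ t₃.inj).trans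
            (LinearEquiv.ofEq _ _ (LinearMap.exact_iff.1 t₃.exact).symm))⟩,
        ModuleCat.of A (P₁ × P₃), _, _,
        inferInstanceAs (Module.Finite A (P₁ × P₃)),
        inferInstanceAs (Module.Projective A (P₁ × P₃)), isSES_ker hsurj⟩
  exact key.le_gproj ⟨G₁, G₃, a, b, s, h₁, h₃⟩

/-- A module that becomes Gorenstein projective after adding a finitely generated projective module
is Gorenstein projective. -/
theorem Gproj.of_prod {K P : ModuleCat.{u} A} [Module.Finite A P] [Module.Projective A P]
    (h : Gproj A (ModuleCat.of A (K × P))) : Gproj A K := by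
  have key : IsGorensteinClass fun K : ModuleCat.{u} A => ∃ P : ModuleCat.{u} A,
      Module.Finite A P ∧ Module.Projective A P ∧ Gproj A (ModuleCat.of A (K × P)) := by
    rintro K ⟨P, _, _, h⟩
    obtain ⟨h0, ⟨C, hC, Q, i, p, _, _, t⟩, ⟨C', hC', Q', i', p', _, _, t'⟩⟩ :=
      isGorensteinClass_gproj _ h
    have hgood : ∀ G : ModuleCat.{u} A, Gproj A G → ∃ P : ModuleCat.{u} A,
        Module.Finite A P ∧ Module.Projective A P ∧ Gproj A (ModuleCat.of A (G × P)) :=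
      fun G hG => ⟨ModuleCat.of A PUnit, inferInstanceAs (Module.Finite A PUnit.{u + 1}),
        inferInstanceAs (Module.Projective A PUnit.{u + 1}),
        hG.congr (LinearEquiv.prodUnique (R := A) (M := G) (M₂ := PUnit.{u + 1})).symm⟩
    have hP : Gproj A P := Gproj.of_projective
    refine ⟨h0.retract (i := LinearMap.inl A K P) (r := LinearMap.fst A K P) fun _ => rfl, ?_, ?_⟩
    -- Embedding K through K × P into Q gives a cokernel that is an extension of C by P. Dually, in
    -- the last bullet the kernel of Q' → K × P → K is an extension of P by C'.
    · have s := isSES_range (f := i ∘ₗ LinearMap.inl A K P) (t.inj.comp LinearMap.inl_injective)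
      obtain ⟨c, hc⟩ := exists_factor_of_surjective s.surj p (fun y hy => by
        obtain ⟨x, rfl⟩ := (s.exact y).1 hy
        exact t.comp_apply _)
      refine ⟨ModuleCat.of A _, hgood _ (Gproj.extension (G₁ := P) (G := ModuleCat.of A _)
        (a := (LinearMap.range (i ∘ₗ LinearMap.inl A K P)).mkQ ∘ₗ i ∘ₗ LinearMap.inr A K P)
        (b := c) ⟨?_, ?_, ?_⟩ hP hC),
        Q, _, _, inferInstance, inferInstance, s⟩
      · rw [injective_iff_map_eq_zero]
        intro x hx
        obtain ⟨y, hy⟩ := (s.exact _).1 hx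
        exact (Prod.mk.inj (t.inj hy)).2.symm
      · intro x
        obtain ⟨y, rfl⟩ := t.surj x
        exact ⟨_, hc y⟩
      · intro x
        constructor
        · intro hx
          obtain ⟨y, rfl⟩ := s.surj x
          rw [hc] at hx
          obtain ⟨⟨z, w⟩, rfl⟩ := (t.exact y).1 hx
          refine ⟨w, ?_⟩
          have h1 : i (z, w) = i (LinearMap.inl A K P z) + i (LinearMap.inr A K P w) := by
            rw [← map_add]
            simp
          rw [h1, map_add]
          have h2 := s.comp_apply z
          rw [LinearMap.comp_apply] at h2
          rw [h2, zero_add]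
          rfl
        · rintro ⟨y, rfl⟩
          exact (hc _).trans (t.comp_apply _)
    · obtain ⟨c, d, s'⟩ := t'.exists_ker_comp (isSES_inr_fst (R := A) (X := K) (Y := P))
      exact ⟨ModuleCat.of A _, hgood _ (Gproj.extension (G := ModuleCat.of A _) s' hC' hP),
        Q', _, _, inferInstance, inferInstance,
        isSES_ker (g := LinearMap.fst A K P ∘ₗ p')
          ((LinearMap.fst_surjective : Function.Surjective (LinearMap.fst A K P)).comp t'.surj)⟩
  exact key.le_gproj ⟨P, inferInstance, inferInstance, h⟩

/-- A syzygy of a Gorenstein projective module is Gorenstein projective. -/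
theorem Gproj.syzygy {K P G : ModuleCat.{u} A} [Module.Finite A P] [Module.Projective A P]
    {i : K →ₗ[A] P} {p : P →ₗ[A] G} (s : IsSES i p) (h : Gproj A G) : Gproj A K := by
  obtain ⟨G₀, hG₀, P₀, i₀, p₀, _, _, s₀⟩ := (isGorensteinClass_gproj G h).2.2
  -- Schanuel's argument: the kernel E is an extension of P by G₀, hence Gorenstein projective, and
  -- also an extension of P₀ by K, which splits.
  let π : P₀ × P →ₗ[A] G := p₀.coprod p
  let E := LinearMap.ker π
  have hE : ∀ x y, (x, y) ∈ E ↔ p₀ x + p y = 0 := fun x y => Iff.rfl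
  have s₁ : IsSES ((LinearMap.inl A P₀ P ∘ₗ i₀).codRestrict E fun x => by
      simp [E, π, s₀.comp_apply]) (LinearMap.snd A P₀ P ∘ₗ E.subtype) := by
    refine ⟨fun x y hxy => s₀.inj (congrArg (fun z : E => z.1.1) hxy), fun x => ?_, ?_⟩
    · obtain ⟨y, hy⟩ := s₀.surj (p x)
      exact ⟨⟨(-y, x), by simp [hE, hy]⟩, rfl⟩
    · rintro ⟨⟨x, y⟩, hxy⟩
      constructor
      · intro hy
        have hy : y = 0 := hy
        subst hy
        obtain ⟨z, rfl⟩ := (s₀.exact x).1 (by simpa [hE] using hxy)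
        exact ⟨z, rfl⟩
      · rintro ⟨z, hz⟩
        exact (congrArg (fun z : E => z.1.2) hz).symm
  have s₂ : IsSES ((LinearMap.inr A P₀ P ∘ₗ i).codRestrict E fun x => by
      simp [E, π, s.comp_apply]) (LinearMap.fst A P₀ P ∘ₗ E.subtype) := by
    refine ⟨fun x y hxy => s.inj (congrArg (fun z : E => z.1.2) hxy), fun x => ?_, ?_⟩
    · obtain ⟨y, hy⟩ := s.surj (p₀ x)
      exact ⟨⟨(x, -y), by simp [hE, hy]⟩, rfl⟩
    · rintro ⟨⟨x, y⟩, hxy⟩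
      constructor
      · intro hx
        have hx : x = 0 := hx
        subst hx
        obtain ⟨z, rfl⟩ := (s.exact y).1 (by simpa [hE] using hxy)
        exact ⟨z, rfl⟩
      · rintro ⟨z, hz⟩
        exact (congrArg (fun z : E => z.1.1) hz).symm
  have h₁ : Gproj A (ModuleCat.of A E) := Gproj.extension (G := ModuleCat.of A E) s₁ hG₀
    Gproj.of_projective
  obtain ⟨r, hr⟩ := (ExtVanish.of_projective (R := A) (G := P₀) (N := K)).extend s₂
    (LinearMap.id : K →ₗ[A] K)
  exact Gproj.of_prod (P := P₀) (h₁.congr (G' := ModuleCat.of A (K × P₀)) (s₂.prodEquiv r hr))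

/-- A left approximation of a Gorenstein projective module by a finitely generated projective
module is injective, and its cokernel is Gorenstein projective. -/
theorem Gproj.approximation {G P : ModuleCat.{u} A} [Module.Finite A P] [Module.Projective A P]
    (h : Gproj A G) (f : G →ₗ[A] P)
    (hf : ∀ w : G →ₗ[A] A, ∃ v : P →ₗ[A] A, ∀ x, v (f x) = w x) :
    Function.Injective f ∧ Gproj A (ModuleCat.of A (P ⧸ LinearMap.range f)) := by
  obtain ⟨G₀, hG₀, P₀, i₀, p₀, _, _, s₀⟩ := (isGorensteinClass_gproj G h).2.1
  obtain ⟨n, i, r, hir⟩ := exists_retract_pi (R := A) (N := P₀)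
  choose v hv using fun j => hf (LinearMap.proj j ∘ₗ i ∘ₗ i₀)
  -- Functionals on G factor through f, hence so does the embedding i₀ into the projective module
  -- P₀; this already makes f injective.
  obtain ⟨t, ht⟩ : ∃ t : P →ₗ[A] P₀, ∀ x, t (f x) = i₀ x := by
    refine ⟨r ∘ₗ LinearMap.pi v, fun x => ?_⟩
    rw [← hir (i₀ x), LinearMap.comp_apply]
    congr 1
    ext j
    exact hv j x
  have hinj : Function.Injective f := fun x y hxy => s₀.inj (by rw [← ht, ← ht, hxy])
  refine ⟨hinj, ?_⟩
  have s := isSES_range hinj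
  -- The cokernel of φ is the pushout of f and i₀. It is an extension of G₀ by P, hence Gorenstein
  -- projective, and an extension of coker f by P₀ that is split by t.
  let φ : G →ₗ[A] P × P₀ := f.prod (-i₀)
  have sE := isSES_range (f := φ) fun x y hxy => hinj (Prod.mk.inj hxy).1
  obtain ⟨b₁, hb₁⟩ := exists_factor_of_surjective sE.surj (p₀ ∘ₗ LinearMap.snd A P P₀)
    (fun y hy => by
      obtain ⟨x, rfl⟩ := (sE.exact y).1 hy
      simp [φ, s₀.comp_apply])
  obtain ⟨b₂, hb₂⟩ := exists_factor_of_surjective sE.surj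
    ((LinearMap.range f).mkQ ∘ₗ LinearMap.fst A P P₀) (fun y hy => by
      obtain ⟨x, rfl⟩ := (sE.exact y).1 hy
      exact s.comp_apply x)
  obtain ⟨r₂, hr₂⟩ := exists_factor_of_surjective sE.surj (t.coprod LinearMap.id)
    (fun y hy => by
      obtain ⟨x, rfl⟩ := (sE.exact y).1 hy
      simp [φ, ht])
  have s₁ : IsSES ((LinearMap.range φ).mkQ ∘ₗ LinearMap.inl A P P₀) b₁ := by
    refine ⟨?_, fun x => ?_, fun x => ⟨fun hx => ?_, ?_⟩⟩
    · rw [injective_iff_map_eq_zero]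
      intro x hx
      obtain ⟨y, hy⟩ := (sE.exact _).1 hx
      have h1 : -i₀ y = 0 := (Prod.mk.inj hy).2
      have h2 : y = 0 := s₀.inj (by rw [map_zero, ← neg_eq_zero, h1])
      exact (Prod.mk.inj hy).1.symm.trans ((congrArg f h2).trans (map_zero f))
    · obtain ⟨y, rfl⟩ := s₀.surj x
      exact ⟨_, hb₁ (0, y)⟩
    · obtain ⟨⟨y, z⟩, rfl⟩ := sE.surj x
      rw [hb₁] at hx
      obtain ⟨w, rfl⟩ := (s₀.exact z).1 hx
      refine ⟨y + f w, ?_⟩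
      rw [LinearMap.comp_apply, ← sub_eq_zero, ← map_sub]
      refine (sE.exact _).2 ⟨w, Prod.ext ?_ ?_⟩ <;> simp [φ]
    · rintro ⟨y, rfl⟩
      rw [LinearMap.comp_apply, hb₁]
      simp
  have s₂ : IsSES ((LinearMap.range φ).mkQ ∘ₗ LinearMap.inr A P P₀) b₂ := by
    refine ⟨?_, fun x => ?_, fun x => ⟨fun hx => ?_, ?_⟩⟩
    · rw [injective_iff_map_eq_zero]
      intro x hx
      obtain ⟨y, hy⟩ := (sE.exact _).1 hx
      have h2 : y = 0 := hinj ((Prod.mk.inj hy).1.trans (map_zero f).symm)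
      exact (Prod.mk.inj hy).2.symm.trans ((congrArg (-i₀) h2).trans (map_zero (-i₀)))
    · obtain ⟨y, rfl⟩ := s.surj x
      exact ⟨_, hb₂ (y, 0)⟩
    · obtain ⟨⟨y, z⟩, rfl⟩ := sE.surj x
      rw [hb₂] at hx
      obtain ⟨w, rfl⟩ := (s.exact y).1 hx
      refine ⟨z + i₀ w, ?_⟩
      rw [LinearMap.comp_apply, ← sub_eq_zero, ← map_sub]
      refine (sE.exact _).2 ⟨-w, Prod.ext ?_ ?_⟩ <;> simp [φ]
    · rintro ⟨y, rfl⟩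
      rw [LinearMap.comp_apply, hb₂]
      simp
  have hE : Gproj A (ModuleCat.of A _) := Gproj.extension (G := ModuleCat.of A _) s₁
    Gproj.of_projective hG₀
  have e := s₂.prodEquiv r₂ fun x => by
    rw [LinearMap.comp_apply, hr₂]
    simp
  exact Gproj.of_prod (P := P₀) (K := ModuleCat.of A (P ⧸ LinearMap.range f))
    (hE.congr (G' := ModuleCat.of A ((P ⧸ LinearMap.range f) × P₀))
      (e.trans (LinearEquiv.prodComm A _ _)))

end Gproj

noncomputable section

/-! ### Right exactness of the balanced tensor product. -/

section RightExact

variable {T R M : Type u} [Ring T] [Ring R] [AddCommGroup M] [Module T M]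
  [Module Rᵐᵒᵖ M] [SMulCommClass T Rᵐᵒᵖ M]
  {X Y Z : Type u} [AddCommGroup X] [Module R X] [AddCommGroup Y] [Module R Y]
  [AddCommGroup Z] [Module R Z]

theorem balanced_induction {p : BalancedTensor T R M X → Prop}
    (hmk : ∀ (m : M) (x : X), p (Submodule.Quotient.mk (m ⊗ₜ[ℤ] x)))
    (hadd : ∀ s t, p s → p t → p (s + t)) (h0 : p 0) (t : BalancedTensor T R M X) : p t := by
  obtain ⟨t, rfl⟩ := Submodule.Quotient.mk_surjective _ t
  induction t using TensorProduct.induction_on with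
  | zero => exact h0
  | tmul m x => exact hmk m x
  | add s t hs ht => exact hadd _ _ hs ht

theorem balancedMap_comp (g : Y →ₗ[R] Z) (f : X →ₗ[R] Y) :
    balancedMap T R M (g ∘ₗ f) = balancedMap T R M g ∘ₗ balancedMap T R M f :=
  balanced_hom_ext fun m x => by simp

theorem balancedMap_surjective {g : Y →ₗ[R] Z} (hg : Function.Surjective g) :
    Function.Surjective (balancedMap T R M g) := by
  intro z
  induction z using balanced_induction with
  | hmk m z =>
    obtain ⟨y, rfl⟩ := hg z
    exact ⟨Submodule.Quotient.mk (m ⊗ₜ y), by simp⟩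
  | hadd s t hs ht =>
    obtain ⟨s, rfl⟩ := hs
    obtain ⟨t, rfl⟩ := ht
    exact ⟨s + t, map_add _ _ _⟩
  | h0 => exact ⟨0, map_zero _⟩

omit [SMulCommClass T Rᵐᵒᵖ M] in
theorem balancedRel_le_map {g : Y →ₗ[R] Z} (hg : Function.Surjective g) :
    balancedRel T R M Z ≤ (balancedRel T R M Y).map
      (TensorProduct.AlgebraTensorModule.map (LinearMap.id : M →ₗ[T] M)
        g.toAddMonoidHom.toIntLinearMap) := by
  rw [balancedRel, Submodule.span_le]
  rintro _ ⟨m, r, z, rfl⟩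
  obtain ⟨y, rfl⟩ := hg z
  exact ⟨_, Submodule.subset_span ⟨m, r, y, rfl⟩, by simp⟩

/-- Balancing relations lift along the surjection g, so an element of the kernel can be corrected by
relations until exactness of the tensor product over ℤ applies. -/
theorem balancedMap_exact {f : X →ₗ[R] Y} {g : Y →ₗ[R] Z} (hg : Function.Surjective g)
    (h : Function.Exact f g) : Function.Exact (balancedMap T R M f) (balancedMap T R M g) := by
  intro y
  constructor
  · intro hy
    obtain ⟨t, rfl⟩ := Submodule.Quotient.mk_surjective _ y
    have h1 : TensorProduct.AlgebraTensorModule.map (LinearMap.id : M →ₗ[T] M)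
        g.toAddMonoidHom.toIntLinearMap t ∈ balancedRel T R M Z :=
      (Submodule.Quotient.mk_eq_zero _).1 hy
    obtain ⟨r, hr, hrt⟩ := balancedRel_le_map hg h1
    have h2 : Function.Exact (LinearMap.lTensor M f.toAddMonoidHom.toIntLinearMap)
        (LinearMap.lTensor M g.toAddMonoidHom.toIntLinearMap) :=
      lTensor_exact M (f := f.toAddMonoidHom.toIntLinearMap)
        (g := g.toAddMonoidHom.toIntLinearMap) h hg
    obtain ⟨s, hs⟩ := (h2 (t - r)).1 (by
      rw [map_sub, sub_eq_zero]
      exact hrt.symm)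
    refine ⟨Submodule.Quotient.mk s, ?_⟩
    have h3 : balancedMap T R M f (Submodule.Quotient.mk s) = Submodule.Quotient.mk (t - r) :=
      congrArg Submodule.Quotient.mk hs
    rw [h3, Submodule.Quotient.mk_sub, (Submodule.Quotient.mk_eq_zero _).2 hr, sub_zero]
  · rintro ⟨x, rfl⟩
    have : g ∘ₗ f = 0 := LinearMap.ext fun x => h.apply_apply_eq_zero x
    rw [← LinearMap.comp_apply, ← balancedMap_comp, this]
    induction x using balanced_induction with
    | hmk m z => simp
    | hadd s t hs ht => rw [map_add, hs, ht, add_zero]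
    | h0 => simp

end RightExact

/-! ### The module (A ⊗ V) ⊗_Λ X as V ⊗_B X. -/

section IndTensor

variable (k : Type u) {A B : Type u} [Field k] [Ring A] [Algebra k A] [Ring B] [Algebra k B]
  {V : Type u} [AddCommGroup V] [Module k V] [Module Bᵐᵒᵖ V] [IsScalarTower k Bᵐᵒᵖ V]
  {X Y Z : Type u} [AddCommGroup X] [Module (A ⊗[k] B) X] [AddCommGroup Y] [Module (A ⊗[k] B) Y]
  [AddCommGroup Z] [Module (A ⊗[k] B) Z]

variable (A B V X) in
/-- The `A`-module `(A ⊗ V) ⊗_Λ X`, whose underlying abelian group is `V ⊗_B X`. -/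
abbrev IndTensor : Type u := BalancedTensor A (A ⊗[k] B) (Ind k A V) X

variable (A B) in
/-- The class of `(1 ⊗ v) ⊗ x`. -/
def tmk (v : V) (x : X) : IndTensor k A B V X :=
  Submodule.Quotient.mk ((show Ind k A V from (1 : A) ⊗ₜ[k] v) ⊗ₜ[ℤ] x)

theorem tmk_add_left (v w : V) (x : X) : tmk k A B (v + w) x = tmk k A B v x + tmk k A B w x := by
  have : (show Ind k A V from (1 : A) ⊗ₜ[k] (v + w)) =
    (show Ind k A V from (1 : A) ⊗ₜ[k] v) + (show Ind k A V from (1 : A) ⊗ₜ[k] w) :=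
    TensorProduct.tmul_add _ _ _
  rw [tmk, this, TensorProduct.add_tmul, Submodule.Quotient.mk_add]
  rfl

theorem tmk_add_right (v : V) (x y : X) : tmk k A B v (x + y) = tmk k A B v x + tmk k A B v y := by
  rw [tmk, TensorProduct.tmul_add, Submodule.Quotient.mk_add]
  rfl

theorem mk_smul_tmul (m : Ind k A V) (r : A ⊗[k] B) (x : X) :
    (Submodule.Quotient.mk ((MulOpposite.op r • m) ⊗ₜ[ℤ] x) : IndTensor k A B V X) =
      Submodule.Quotient.mk (m ⊗ₜ[ℤ] (r • x)) :=
  (Submodule.Quotient.eq _).2 (Submodule.subset_span ⟨m, r, x, rfl⟩)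

theorem mk_tmul_tmul (a : A) (v : V) (x : X) :
    (Submodule.Quotient.mk ((show Ind k A V from a ⊗ₜ[k] v) ⊗ₜ[ℤ] x) : IndTensor k A B V X) =
      tmk k A B v ((a ⊗ₜ[k] (1 : B)) • x) := by
  rw [tmk, ← mk_smul_tmul, ind_op_smul_tmul]
  simp

theorem tmk_op_smul (b : B) (v : V) (x : X) :
    (tmk k A B (MulOpposite.op b • v) x : IndTensor k A B V X) =
      tmk k A B v (((1 : A) ⊗ₜ[k] b) • x) := by
  rw [tmk, tmk, ← mk_smul_tmul, ind_op_smul_tmul, mul_one]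

theorem smul_tmk (a : A) (v : V) (x : X) :
    a • (tmk k A B v x : IndTensor k A B V X) = tmk k A B v ((a ⊗ₜ[k] (1 : B)) • x) := by
  rw [← mk_tmul_tmul, tmk, ← Submodule.Quotient.mk_smul, TensorProduct.smul_tmul']
  congr 2
  exact (TensorProduct.smul_tmul' _ _ _).trans (by simp)

theorem tmk_smul (c : k) (v : V) (x : X) :
    (tmk k A B (c • v) x : IndTensor k A B V X) = algebraMap k A c • tmk k A B v x := by
  have : c • v = MulOpposite.op (algebraMap k B c) • v := by
    rw [← MulOpposite.algebraMap_apply, algebraMap_smul]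
  rw [this, tmk_op_smul, smul_tmk, Algebra.algebraMap_eq_smul_one, Algebra.algebraMap_eq_smul_one,
    TensorProduct.smul_tmul]

variable {k}

theorem tmk_induction {p : IndTensor k A B V X → Prop} (hmk : ∀ v x, p (tmk k A B v x))
    (hadd : ∀ s t, p s → p t → p (s + t)) (h0 : p 0) (t : IndTensor k A B V X) : p t := by
  induction t using balanced_induction with
  | hmk m x =>
    induction m using TensorProduct.induction_on with
    | zero =>
      have : (show Ind k A V from (0 : A ⊗[k] V)) ⊗ₜ[ℤ] x = 0 := TensorProduct.zero_tmul _ _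
      exact this ▸ h0
    | tmul a v => 
      have := mk_tmul_tmul k (B := B) a v x
      exact this ▸ hmk _ _
    | add m n hm hn =>
      have : (show Ind k A V from (m + n : A ⊗[k] V)) ⊗ₜ[ℤ] x =
        (show Ind k A V from m) ⊗ₜ[ℤ] x + (show Ind k A V from n) ⊗ₜ[ℤ] x :=
        TensorProduct.add_tmul _ _ _
      exact this ▸ hadd _ _ hm hn
  | hadd s t hs ht => exact hadd s t hs ht
  | h0 => exact h0

theorem indTensor_addHom_ext {N : Type*} [AddCommGroup N] {f g : IndTensor k A B V X →+ N}
    (h : ∀ v x, f (tmk k A B v x) = g (tmk k A B v x)) : f = g := by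
  ext t
  induction t using tmk_induction with
  | hmk v x => exact h v x
  | hadd s t hs ht => rw [map_add, map_add, hs, ht]
  | h0 => rw [map_zero, map_zero]

/-- This is the universal property of V ⊗_B X: the factor A is absorbed into X through a ⊗ 1, so
only balancedness over B has to be checked. -/
theorem exists_indTensor_lift {N : Type*} [AddCommGroup N] (τ : V →+ X →+ N)
    (hτ : ∀ (b : B) v x, τ (MulOpposite.op b • v) x = τ v (((1 : A) ⊗ₜ[k] b) • x)) :
    ∃ F : IndTensor k A B V X →+ N, ∀ v x, F (tmk k A B v x) = τ v x := by
  let f₀ : A →+ V →+ X →+ N := AddMonoidHom.mk' (fun a => AddMonoidHom.mk' (fun v =>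
    (τ v).comp (DistribSMul.toAddMonoidHom X (a ⊗ₜ[k] (1 : B))))
    (fun v w => by ext x; simp)) (fun a b => by
      ext v x
      simp [TensorProduct.add_tmul, add_smul])
  let f₁ : A ⊗[k] V →+ X →+ N := TensorProduct.liftAddHom f₀ fun c a v => by
    ext x
    have : c • v = MulOpposite.op (algebraMap k B c) • v := by
      rw [← MulOpposite.algebraMap_apply, algebraMap_smul]
    change τ v (((c • a) ⊗ₜ[k] (1 : B)) • x) = τ (c • v) ((a ⊗ₜ[k] (1 : B)) • x)
    rw [this, hτ, smul_smul, Algebra.TensorProduct.tmul_mul_tmul, one_mul, mul_one,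
      Algebra.algebraMap_eq_smul_one, TensorProduct.smul_tmul]
  let f₂ : Ind k A V ⊗[ℤ] X →+ N := TensorProduct.liftAddHom (show Ind k A V →+ X →+ N from f₁)
    fun c m x => by
      rw [map_zsmul, map_zsmul]
      rfl
  have hf₂ : ∀ a v x, f₂ ((show Ind k A V from a ⊗ₜ[k] v) ⊗ₜ[ℤ] x) =
      τ v ((a ⊗ₜ[k] (1 : B)) • x) := fun a v x => rfl
  have hrel : ∀ (m : Ind k A V) (r : A ⊗[k] B) (x : X),
      f₂ ((MulOpposite.op r • m) ⊗ₜ[ℤ] x) = f₂ (m ⊗ₜ[ℤ] (r • x)) := by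
    intro m r x
    induction r using TensorProduct.induction_on with
    | zero => simp
    | add r s hr hs =>
      rw [MulOpposite.op_add, add_smul, add_smul, TensorProduct.add_tmul, TensorProduct.tmul_add,
        map_add, map_add, hr, hs]
    | tmul a b =>
      induction m using TensorProduct.induction_on with
      | zero =>
        have h1 : (show Ind k A V from (0 : A ⊗[k] V)) = 0 := rfl
        have h2 : f₂ ((MulOpposite.op (a ⊗ₜ[k] b) • (0 : Ind k A V)) ⊗ₜ[ℤ] x) =
          f₂ ((0 : Ind k A V) ⊗ₜ[ℤ] ((a ⊗ₜ[k] b) • x)) := by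
          rw [smul_zero, TensorProduct.zero_tmul, TensorProduct.zero_tmul]
        exact h2
      | tmul a' v =>
        have := ind_op_smul_tmul k A B V a' a b v
        refine (congrArg (fun m => f₂ (m ⊗ₜ[ℤ] x)) this).trans ?_
        rw [hf₂, hf₂, hτ, smul_smul, smul_smul, Algebra.TensorProduct.tmul_mul_tmul,
          Algebra.TensorProduct.tmul_mul_tmul]
        simp
      | add m n hm hn =>
        have h2 : ∀ m n : Ind k A V, 
          f₂ ((MulOpposite.op (a ⊗ₜ[k] b) • m) ⊗ₜ[ℤ] x) = f₂ (m ⊗ₜ[ℤ] ((a ⊗ₜ[k] b) • x)) →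
          f₂ ((MulOpposite.op (a ⊗ₜ[k] b) • n) ⊗ₜ[ℤ] x) = f₂ (n ⊗ₜ[ℤ] ((a ⊗ₜ[k] b) • x)) →
          f₂ ((MulOpposite.op (a ⊗ₜ[k] b) • (m + n)) ⊗ₜ[ℤ] x) =
            f₂ ((m + n) ⊗ₜ[ℤ] ((a ⊗ₜ[k] b) • x)) := by
          intro m n hm hn
          rw [smul_add, TensorProduct.add_tmul, TensorProduct.add_tmul, map_add, map_add, hm, hn]
        exact h2 m n hm hn
  have hker : ∀ t ∈ balancedRel A (A ⊗[k] B) (Ind k A V) X, f₂ t = 0 := by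
    intro t ht
    have : balancedRel A (A ⊗[k] B) (Ind k A V) X = Submodule.span A {z | ∃ (m : Ind k A V)
      (r : A ⊗[k] B) (x : X), z = (MulOpposite.op r • m) ⊗ₜ[ℤ] x - m ⊗ₜ[ℤ] (r • x)} := rfl
    rw [this] at ht
    induction ht using Submodule.closure_induction with
    | zero => exact map_zero _
    | add s t _ _ hs ht => rw [map_add, hs, ht, add_zero]
    | smul_mem a t ht =>
      obtain ⟨m, r, x, rfl⟩ := ht
      rw [smul_sub, TensorProduct.smul_tmul', TensorProduct.smul_tmul', map_sub, sub_eq_zero,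
        smul_comm, hrel]
  let F : IndTensor k A B V X →+ N :=
    QuotientAddGroup.lift (balancedRel A (A ⊗[k] B) (Ind k A V) X).toAddSubgroup f₂ hker
  refine ⟨F, fun v x => ?_⟩
  change f₂ ((show Ind k A V from (1 : A) ⊗ₜ[k] v) ⊗ₜ[ℤ] x) = _
  rw [hf₂, ← Algebra.TensorProduct.one_def, one_smul]

@[simp]
theorem balancedMap_tmk (f : X →ₗ[A ⊗[k] B] Y) (v : V) (x : X) :
    balancedMap A (A ⊗[k] B) (Ind k A V) f (tmk k A B v x) = tmk k A B v (f x) :=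
  balancedMap_mk _ _ _ _ _ _

end IndTensor

/-! ### Restriction from A ⊗ B to B. -/

section RestrictB

variable (k A B : Type u) [Field k] [Ring A] [Algebra k A] [Ring B] [Algebra k B]
  (X Y Z : Type u) [AddCommGroup X] [Module (A ⊗[k] B) X] [AddCommGroup Y] [Module (A ⊗[k] B) Y]
  [AddCommGroup Z] [Module (A ⊗[k] B) Z]

/-- The restriction of an `A ⊗ B`-module to `B`. -/
@[nolint unusedArguments]
def ResB (_k _A _B X : Type u) : Type u := X

instance : AddCommGroup (ResB k A B X) := inferInstanceAs (AddCommGroup X)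

instance : Module B (ResB k A B X) :=
  Module.compHom X (Algebra.TensorProduct.includeRight : B →ₐ[k] A ⊗[k] B).toRingHom

variable {X Y Z}

/-- An `A ⊗ B`-linear map as a `B`-linear map. -/
def resMap (f : X →ₗ[A ⊗[k] B] Y) : ResB k A B X →ₗ[B] ResB k A B Y where
  toFun := f
  map_add' := f.map_add
  map_smul' b x := f.map_smul ((1 : A) ⊗ₜ[k] b) x

theorem IsSES.resMap {f : X →ₗ[A ⊗[k] B] Y} {g : Y →ₗ[A ⊗[k] B] Z} (s : IsSES f g) :
    IsSES (resMap k A B f) (resMap k A B g) := ⟨s.inj, s.surj, s.exact⟩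

variable (X) in
instance : Module k (ResB k A B X) :=
  Module.compHom X (algebraMap k (A ⊗[k] B))

instance : IsScalarTower k B (ResB k A B X) where
  smul_assoc c b x := by
    change ((1 : A) ⊗ₜ[k] (c • b)) • (show X from x) =
      algebraMap k (A ⊗[k] B) c • ((1 : A) ⊗ₜ[k] b) • (show X from x)
    rw [smul_smul, Algebra.algebraMap_eq_smul_one, smul_mul_assoc, one_mul,
      TensorProduct.tmul_smul]

instance finiteDimensional_resB [FiniteDimensional k A] [FiniteDimensional k B]
    [Module.Finite (A ⊗[k] B) X] : FiniteDimensional k (ResB k A B X) := by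
  let _ : Module k X := Module.compHom X (algebraMap k (A ⊗[k] B))
  have : IsScalarTower k (A ⊗[k] B) X := ⟨fun c r x => by
    change (c • r) • x = algebraMap k (A ⊗[k] B) c • r • x
    rw [smul_smul, Algebra.smul_def]⟩
  exact Module.Finite.trans (A ⊗[k] B) X

instance finite_resB [FiniteDimensional k A] [FiniteDimensional k B]
    [Module.Finite (A ⊗[k] B) X] : Module.Finite B (ResB k A B X) :=
  Module.Finite.of_restrictScalars_finite k B _

/-- `A ⊗ B` is free as a `B`-module. -/
def resBTensorEquiv : B ⊗[k] A ≃ₗ[B] ResB k A B (A ⊗[k] B) :=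
  { (TensorProduct.comm k B A).toAddEquiv with
    map_smul' := fun b x => by
      change (TensorProduct.comm k B A) (b • x) =
        ((1 : A) ⊗ₜ[k] b) • (TensorProduct.comm k B A) x
      induction x using TensorProduct.induction_on with
      | zero => simp
      | tmul c a => simp [TensorProduct.smul_tmul']
      | add x y hx hy => rw [smul_add, map_add, map_add, smul_add, hx, hy] }

/-- A projective Λ-module is a retract of a free one, and Λ is free over B. -/
instance projective_resB [Module.Projective (A ⊗[k] B) X] :
    Module.Projective B (ResB k A B X) := by
  have h1 : Module.Free B (ResB k A B (A ⊗[k] B)) := Module.Free.of_equiv (resBTensorEquiv k A B)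
  have h2 : Module.Projective B (X →₀ ResB k A B (A ⊗[k] B)) := inferInstance
  obtain ⟨s, hs⟩ := Module.Projective.out (R := A ⊗[k] B) (P := X)
  let j : ResB k A B (X →₀ A ⊗[k] B) →ₗ[B] X →₀ ResB k A B (A ⊗[k] B) :=
    { toFun := fun f => f
      map_add' := fun f g => rfl
      map_smul' := fun b f => rfl }
  let j' : (X →₀ ResB k A B (A ⊗[k] B)) →ₗ[B] ResB k A B (X →₀ A ⊗[k] B) :=
    { toFun := fun f => f
      map_add' := fun f g => rfl
      map_smul' := fun b f => rfl }
  exact Module.Projective.of_split (j ∘ₗ resMap k A B s)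
    (resMap k A B (Finsupp.linearCombination (A ⊗[k] B) id) ∘ₗ j') (LinearMap.ext hs)

end RestrictB

/-! ### Functoriality of (A ⊗ V) ⊗_Λ X in B-linear maps. -/

section Tmap

variable {k A B : Type u} [Field k] [Ring A] [Algebra k A] [Ring B] [Algebra k B]
  {V : Type u} [AddCommGroup V] [Module k V] [Module Bᵐᵒᵖ V] [IsScalarTower k Bᵐᵒᵖ V]
  {X Y Z : Type u} [AddCommGroup X] [Module (A ⊗[k] B) X] [AddCommGroup Y] [Module (A ⊗[k] B) Y]
  [AddCommGroup Z] [Module (A ⊗[k] B) Z]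

-- The underlying group depends only on the B-module X, so B-linear maps act, though merely
-- additively. Hence a B-splitting is enough for injectivity.
variable (V) in
theorem exists_indTensor_map (h : ResB k A B X →ₗ[B] ResB k A B Y) :
    ∃ F : IndTensor k A B V X →+ IndTensor k A B V Y,
      ∀ v x, F (tmk k A B v x) = tmk k A B (X := Y) v (h x) := by
  refine exists_indTensor_lift (X := X) (AddMonoidHom.mk' (fun v => AddMonoidHom.mk' (M := X)
    (fun x => tmk k A B (X := Y) v (h x)) fun x y => ?_) fun v w => ?_) fun b v x => ?_
  · refine Eq.trans ?_ (tmk_add_right (X := Y) k v (h x) (h y))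
    exact congrArg (tmk k A B (X := Y) v) (h.map_add x y)
  · ext x
    exact tmk_add_left (X := Y) k v w (h x)
  · refine (tmk_op_smul (X := Y) k b v (h x)).trans ?_
    exact congrArg (tmk k A B (X := Y) v) (h.map_smul b x).symm

variable (V) in
theorem balancedMap_injective_of_retraction {f : X →ₗ[A ⊗[k] B] Y}
    (ρ : ResB k A B Y →ₗ[B] ResB k A B X) (h : ∀ x, ρ (resMap k A B f x) = x) :
    Function.Injective (balancedMap A (A ⊗[k] B) (Ind k A V) f) := by
  obtain ⟨F, hF⟩ := exists_indTensor_map (X := Y) (Y := X) V ρ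
  have : F.comp (balancedMap A (A ⊗[k] B) (Ind k A V) f).toAddMonoidHom = AddMonoidHom.id _ :=
    indTensor_addHom_ext fun v x => by
      change F (balancedMap A (A ⊗[k] B) (Ind k A V) f (tmk k A B v x)) = tmk k A B v x
      rw [balancedMap_tmk, hF]
      exact congrArg (tmk k A B v) (h x)
  exact Function.LeftInverse.injective (g := F) fun x => DFunLike.congr_fun this x

-- The sequence splits over B since Z is B-projective; the induced additive retraction gives
-- injectivity on the left.
variable (V) in
theorem IsSES.balancedMap {f : X →ₗ[A ⊗[k] B] Y} {g : Y →ₗ[A ⊗[k] B] Z} (s : IsSES f g)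
    [Module.Projective B (ResB k A B Z)] :
    IsSES (MonRep.balancedMap A (A ⊗[k] B) (Ind k A V) f)
      (MonRep.balancedMap A (A ⊗[k] B) (Ind k A V) g) := by
  obtain ⟨ρ, hρ⟩ := (ExtVanish.of_projective (R := B) (G := ResB k A B Z)
    (N := ResB k A B X)).extend (s.resMap k A B) LinearMap.id
  exact ⟨balancedMap_injective_of_retraction V ρ hρ, balancedMap_surjective s.surj,
    balancedMap_exact s.surj s.exact⟩

end Tmap

/-! ### The right adjoint Hom_k(V, N). -/

section Coind

variable (k A B V N : Type u) [Field k] [Ring A] [Algebra k A] [Ring B] [Algebra k B]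
  [AddCommGroup V] [Module k V] [Module Bᵐᵒᵖ V] [IsScalarTower k Bᵐᵒᵖ V]
  [AddCommGroup N] [Module k N] [Module A N] [IsScalarTower k A N]

/-- `Hom_k(V, N)` as a left `A ⊗ B`-module, for a right `B`-module `V` and a left `A`-module `N`. -/
def Coind : Type u := V →ₗ[k] N

instance : AddCommGroup (Coind k V N) := inferInstanceAs (AddCommGroup (V →ₗ[k] N))

instance : Module k (Coind k V N) := inferInstanceAs (Module k (V →ₗ[k] N))

instance : FunLike (Coind k V N) V N := inferInstanceAs (FunLike (V →ₗ[k] N) V N)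

instance : LinearMapClass (Coind k V N) k V N :=
  inferInstanceAs (LinearMapClass (V →ₗ[k] N) k V N)

/-- The action of `A ⊗ B` on `Hom_k(V, N)`. -/
def coindAction : A ⊗[k] B →ₐ[k] Module.End k (V →ₗ[k] N) :=
  Algebra.TensorProduct.lift
    (AlgHom.ofLinearMap
      (LinearMap.llcomp k V N N ∘ₗ (Algebra.lsmul k k N : A →ₐ[k] Module.End k N).toLinearMap)
      (by ext; simp) (fun a b => by ext; simp))
    (AlgHom.ofLinearMap
      ((LinearMap.llcomp k V V N).flip ∘ₗ
        (Algebra.lsmul k k V : Bᵐᵒᵖ →ₐ[k] Module.End k V).toLinearMap ∘ₗ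
          (MulOpposite.opLinearEquiv k).toLinearMap)
      (by ext; simp) (fun a b => by ext; simp))
    (fun a b => by
      ext
      simp)

instance : Module (A ⊗[k] B) (Coind k V N) :=
  Module.compHom (V →ₗ[k] N) (coindAction k A B V N).toRingHom

variable {k A B V N}

theorem coind_smul_apply (a : A) (b : B) (h : Coind k V N) (v : V) :
    ((a ⊗ₜ[k] b) • h) v =
      a • h (MulOpposite.op b • v) := by
  change coindAction k A B V N (a ⊗ₜ[k] b) h v = _
  simp [coindAction]
  rfl

theorem coind_ext {g h : Coind k V N} (H : ∀ v, g v =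
    h v) : g = h :=
  LinearMap.ext H

/-- The map `X → Hom_k(V, N)` corresponding to a map `(A ⊗ V) ⊗_Λ X → N`. -/
theorem exists_coind_of_indTensor {X : Type u} [AddCommGroup X] [Module (A ⊗[k] B) X]
    (F : IndTensor k A B V X →ₗ[A] N) : ∃ G : X →ₗ[A ⊗[k] B] Coind k V N,
      ∀ x v, (G x) v = F (tmk k A B v x) := by
  let G : X → Coind k V N := fun x =>
    { toFun := fun v => F (tmk k A B v x)
      map_add' := fun v w => by rw [tmk_add_left, map_add]
      map_smul' := fun c v => by
        rw [tmk_smul, map_smul, algebraMap_smul, RingHom.id_apply] }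
  have hadd : ∀ x y, G (x + y) = G x + G y := fun x y => coind_ext fun v => by
    change F (tmk k A B v (x + y)) = F (tmk k A B v x) + F (tmk k A B v y)
    rw [tmk_add_right, map_add]
  have hzero : ∀ v : V, tmk k A B v (0 : X) = 0 := fun v => by
    have := tmk_add_right (A := A) (B := B) k v (0 : X) 0
    rwa [add_zero, left_eq_add] at this
  refine ⟨{ toFun := G, map_add' := hadd, map_smul' := fun r x => ?_ }, fun x v => rfl⟩
  rw [RingHom.id_apply]
  induction r using TensorProduct.induction_on with
  | zero =>
    rw [zero_smul, zero_smul]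
    exact coind_ext fun v => (congrArg F (hzero v)).trans (map_zero F)
  | tmul a b =>
    refine coind_ext fun v => ?_
    rw [coind_smul_apply]
    change F (tmk k A B v ((a ⊗ₜ[k] b) • x)) = a • F (tmk k A B (MulOpposite.op b • v) x)
    rw [← map_smul, smul_tmk, tmk_op_smul, smul_smul, Algebra.TensorProduct.tmul_mul_tmul, mul_one,
      one_mul]
  | add r s hr hs => rw [add_smul, hadd, hr, hs, add_smul]

/-- The map `(A ⊗ V) ⊗_Λ X → N` corresponding to a map `X → Hom_k(V, N)`. -/
theorem exists_indTensor_of_coind {X : Type u} [AddCommGroup X] [Module (A ⊗[k] B) X]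
    (G : X →ₗ[A ⊗[k] B] Coind k V N) : ∃ F : IndTensor k A B V X →ₗ[A] N,
      ∀ x v, F (tmk k A B v x) = (G x) v := by
  obtain ⟨F, hF⟩ := exists_indTensor_lift (A := A) (B := B) (AddMonoidHom.mk' (fun v =>
    AddMonoidHom.mk' (fun x => (G x) v) fun x y =>
      congrArg (fun f => f v) (G.map_add x y))
    fun v w => by
      ext x
      exact (show V →ₗ[k] N from G x).map_add v w) fun b v x => by
    have := coind_smul_apply (1 : A) b (G x) v
    rw [← map_smul, one_smul] at this
    exact this.symm
  refine ⟨{ F with map_smul' := fun a t => ?_ }, fun x v => hF v x⟩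
  change F (a • t) = a • F t
  induction t using tmk_induction with
  | hmk v x =>
    rw [smul_tmk, hF, hF]
    have := coind_smul_apply a (1 : B) (G x) v
    rw [← map_smul, MulOpposite.op_one, one_smul] at this
    exact this
  | hadd s t hs ht => rw [smul_add, map_add, map_add, smul_add, hs, ht]
  | h0 => rw [smul_zero, map_zero, smul_zero]

omit [Module k N] [IsScalarTower k A N] in
theorem indTensor_hom_ext {X : Type u} [AddCommGroup X] [Module (A ⊗[k] B) X]
    {f g : IndTensor k A B V X →ₗ[A] N}
    (h : ∀ v x, f (tmk k A B v x) = g (tmk k A B v x)) : f = g := by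
  have : f.toAddMonoidHom = g.toAddMonoidHom := indTensor_addHom_ext h
  exact LinearMap.ext fun x => DFunLike.congr_fun this x

/-- Postcomposition as a map of `A ⊗ B`-modules. -/
theorem exists_coind_map_right {N' : Type u} [AddCommGroup N'] [Module k N'] [Module A N']
    [IsScalarTower k A N'] (f : N →ₗ[A] N') :
    ∃ F : Coind k V N →ₗ[A ⊗[k] B] Coind k V N', ∀ h v,
      (F h) v = f (h v) := by
  let F : Coind k V N → Coind k V N' := fun h => (f.restrictScalars k) ∘ₗ (show V →ₗ[k] N from h)
  have hadd : ∀ x y, F (x + y) = F x + F y := fun x y => LinearMap.comp_add _ _ _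
  refine ⟨{ toFun := F, map_add' := hadd, map_smul' := fun r x => ?_ }, fun x v => rfl⟩
  rw [RingHom.id_apply]
  induction r using TensorProduct.induction_on with
  | zero =>
    rw [zero_smul, zero_smul]
    exact LinearMap.comp_zero _
  | tmul a b =>
    refine coind_ext fun v => ?_
    rw [coind_smul_apply]
    refine (congrArg f (coind_smul_apply a b x v)).trans (map_smul f _ _)
  | add r s hr hs => rw [add_smul, hadd, hr, hs, add_smul]

/-- Precomposition as a map of `A ⊗ B`-modules. -/
theorem exists_coind_map_left {V' : Type u} [AddCommGroup V'] [Module k V'] [Module Bᵐᵒᵖ V']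
    [IsScalarTower k Bᵐᵒᵖ V'] (f : V' →ₗ[Bᵐᵒᵖ] V) :
    ∃ F : Coind k V N →ₗ[A ⊗[k] B] Coind k V' N, ∀ h v,
      (F h) v = h (f v) := by
  let F : Coind k V N → Coind k V' N := fun h => (show V →ₗ[k] N from h) ∘ₗ (f.restrictScalars k)
  have hadd : ∀ x y, F (x + y) = F x + F y := fun x y => LinearMap.add_comp _ _ _
  refine ⟨{ toFun := F, map_add' := hadd, map_smul' := fun r x => ?_ }, fun x v => rfl⟩
  rw [RingHom.id_apply]
  induction r using TensorProduct.induction_on with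
  | zero =>
    rw [zero_smul, zero_smul]
    exact LinearMap.zero_comp _
  | tmul a b =>
    refine coind_ext fun v => ?_
    rw [coind_smul_apply]
    refine (coind_smul_apply a b x (f v)).trans ?_
    exact congrArg (fun w => a • x w) (f.map_smul _ v).symm
  | add r s hr hs => rw [add_smul, hadd, hr, hs, add_smul]

end Coind

/-! ### Finiteness and projectivity of (A ⊗ V) ⊗_Λ X. -/

section Finiteness

variable {k A B : Type u} [Field k] [Ring A] [Algebra k A] [Ring B] [Algebra k B]
  {V : Type u} [AddCommGroup V] [Module k V] [Module Bᵐᵒᵖ V] [IsScalarTower k Bᵐᵒᵖ V]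
  {X : Type u} [AddCommGroup X] [Module (A ⊗[k] B) X]

instance finite_indTensor [FiniteDimensional k A] [FiniteDimensional k B] [Module.Finite k V]
    [Module.Finite (A ⊗[k] B) X] : Module.Finite A (IndTensor k A B V X) := by
  let _ : Module k (IndTensor k A B V X) := Module.compHom _ (algebraMap k A)
  have hk : ∀ (c : k) (t : IndTensor k A B V X), c • t = algebraMap k A c • t := fun _ _ => rfl
  have : IsScalarTower k A (IndTensor k A B V X) := ⟨fun c a t => by
    rw [hk, smul_smul, Algebra.smul_def]⟩
  let τ : V →ₗ[k] ResB k A B X →ₗ[k] IndTensor k A B V X :=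
    LinearMap.mk₂ k (fun v x => tmk k A B (X := X) v x) (fun v w x => tmk_add_left (X := X) k v w x)
      (fun c v x => tmk_smul (X := X) k c v x) (fun v x y => tmk_add_right (X := X) k v x y)
      (fun c v x => by
        refine Eq.trans ?_ (smul_tmk (X := X) k (algebraMap k A c) v x).symm
        refine congrArg (tmk k A B (X := X) v) ?_
        rfl)
  have hτ : Function.Surjective (TensorProduct.lift τ) := fun t => by
    induction t using tmk_induction with
    | hmk v x => exact ⟨TensorProduct.tmul k (N := ResB k A B X) v x, rfl⟩
    | hadd s t hs ht =>
      obtain ⟨s, rfl⟩ := hs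
      obtain ⟨t, rfl⟩ := ht
      exact ⟨s + t, map_add _ _ _⟩
    | h0 => exact ⟨0, map_zero _⟩
  have : Module.Finite k (IndTensor k A B V X) := Module.Finite.of_surjective _ hτ
  exact Module.Finite.of_restrictScalars_finite k A _

theorem exists_coind_lift {N N' : Type u} [AddCommGroup N] [Module k N] [Module A N]
    [IsScalarTower k A N] [AddCommGroup N'] [Module k N'] [Module A N'] [IsScalarTower k A N']
    {F : Coind k V N →ₗ[A ⊗[k] B] Coind k V N'} {f : N →ₗ[A] N'} (hf : Function.Surjective f)
    (hF : ∀ h v, F h v = f (h v)) : Function.Surjective F := fun h => by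
  obtain ⟨l, hl⟩ := Module.projective_lifting_property (f.restrictScalars k)
    (show V →ₗ[k] N' from h) hf
  exact ⟨l, coind_ext fun v => (hF l v).trans (LinearMap.congr_fun hl v)⟩

/-- The right adjoint Hom_k(V, -) preserves surjections because k is a field, so the left adjoint
preserves projectives. -/
instance projective_indTensor [Module.Projective (A ⊗[k] B) X] :
    Module.Projective A (IndTensor k A B V X) := by
  refine Module.Projective.of_lifting_property'' fun f hf => ?_
  let _ : Module k (IndTensor k A B V X) := Module.compHom _ (algebraMap k A)
  have hk : ∀ (c : k) (t : IndTensor k A B V X), c • t = algebraMap k A c • t := fun _ _ => rfl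
  have : IsScalarTower k A (IndTensor k A B V X) := ⟨fun c a t => by
    rw [hk, smul_smul, Algebra.smul_def]⟩
  obtain ⟨G, hG⟩ := exists_coind_of_indTensor
    (LinearMap.id : IndTensor k A B V X →ₗ[A] IndTensor k A B V X)
  obtain ⟨F, hF⟩ := exists_coind_map_right (k := k) (B := B) (V := V) f
  obtain ⟨l, hl⟩ := Module.projective_lifting_property F G (exists_coind_lift hf hF)
  obtain ⟨h, hh⟩ := exists_indTensor_of_coind l
  refine ⟨h, indTensor_hom_ext fun v x => ?_⟩
  rw [LinearMap.comp_apply, hh, ← hF, ← LinearMap.comp_apply, hl, hG]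

end Finiteness

/-! ### Coinduction from D(B). -/

section CoindDual

variable (k A B N : Type u) [Field k] [Ring A] [Algebra k A] [Ring B] [Algebra k B]
  [FiniteDimensional k B] [AddCommGroup N] [Module k N] [Module A N] [IsScalarTower k A N]

instance : FiniteDimensional k (RightDual k B) :=
  inferInstanceAs (FiniteDimensional k (B →ₗ[k] k))

instance : Module.Finite Bᵐᵒᵖ (RightDual k B) := Module.Finite.of_restrictScalars_finite k _ _

/-- `B ⊗ N ≃ Hom_k(D(B), N)`. -/
def coindDualEquiv : B ⊗[k] N ≃ₗ[k] Coind k (RightDual k B) N :=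
  (TensorProduct.congr (Module.evalEquiv k B) (LinearEquiv.refl k N)).trans
    (dualTensorHomEquiv k (Module.Dual k B) N)

variable {k B N} in
theorem coindDualEquiv_tmul (b : B) (n : N) (φ : RightDual k B) :
    coindDualEquiv k B N (b ⊗ₜ n) φ = (show B →ₗ[k] k from φ) b • n := by
  change dualTensorHomEquiv k (Module.Dual k B) N
    (TensorProduct.congr (Module.evalEquiv k B) (LinearEquiv.refl k N) (b ⊗ₜ n)) φ = _
  rw [TensorProduct.congr_tmul]
  simp
  rfl

/-- `B ⊗ N ≃ Hom_k(D(B), N)` as `B`-modules. -/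
def resBCoindDualEquiv : B ⊗[k] N ≃ₗ[B] ResB k A B (Coind k (RightDual k B) N) :=
  { (coindDualEquiv k B N).toAddEquiv with
    map_smul' := fun b x => by
      change coindDualEquiv k B N (b • x) = ((1 : A) ⊗ₜ[k] b) • coindDualEquiv k B N x
      induction x using TensorProduct.induction_on with
      | zero => simp
      | tmul c n =>
        refine coind_ext fun φ => ?_
        rw [coind_smul_apply, coindDualEquiv_tmul, one_smul, TensorProduct.smul_tmul',
          coindDualEquiv_tmul]
        rfl
      | add x y hx hy => rw [smul_add, map_add, map_add, smul_add, hx, hy] }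

instance : Module.Projective B (ResB k A B (Coind k (RightDual k B) N)) :=
  Module.Projective.of_equiv' (resBCoindDualEquiv k A B N)

/-- `Hom_k(D(B), A)` is free of rank one over `A ⊗ B`. -/
def coindDualSelfEquiv : A ⊗[k] B ≃ₗ[A ⊗[k] B] Coind k (RightDual k B) A :=
  { ((TensorProduct.comm k A B).trans (coindDualEquiv k B A)).toAddEquiv with
    map_smul' := fun r x => by
      change coindDualEquiv k B A (TensorProduct.comm k A B (r * x)) =
        r • coindDualEquiv k B A (TensorProduct.comm k A B x)
      induction x using TensorProduct.induction_on with
      | zero => simp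
      | add x y hx hy => rw [mul_add, map_add, map_add, map_add, map_add, smul_add, hx, hy]
      | tmul a b =>
        induction r using TensorProduct.induction_on with
        | zero => simp
        | add r s hr hs => rw [add_mul, map_add, map_add, add_smul, hr, hs]
        | tmul a' b' =>
          refine coind_ext fun φ => ?_
          rw [coind_smul_apply, Algebra.TensorProduct.tmul_mul_tmul, TensorProduct.comm_tmul,
            TensorProduct.comm_tmul, coindDualEquiv_tmul, coindDualEquiv_tmul, smul_eq_mul,
            mul_smul_comm]
          rfl }

instance : Module.Projective (A ⊗[k] B) (Coind k (RightDual k B) A) :=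
  Module.Projective.of_equiv' (coindDualSelfEquiv k A B)

instance : Module.Finite (A ⊗[k] B) (Coind k (RightDual k B) A) :=
  Module.Finite.equiv (coindDualSelfEquiv k A B)

end CoindDual

/-! ### Tor computed by a projective resolution. -/

section Tor

variable {T R M : Type u} [Ring T] [Ring R] [AddCommGroup M] [Module T M]
  [Module Rᵐᵒᵖ M] [SMulCommClass T Rᵐᵒᵖ M]

theorem isZero_torModule_iff {X : ModuleCat.{u} R} (P : ProjectiveResolution X) (n : ℕ) :
    Limits.IsZero (torModule T R M (n + 1) X) ↔
      Function.Exact (balancedMap T R M (P.complex.d (n + 1 + 1) (n + 1)).hom)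
        (balancedMap T R M (P.complex.d (n + 1) n).hom) := by
  rw [torModule, (P.isoLeftDerivedObj (tensorFunctor T R M) (n + 1)).isZero_iff]
  change Limits.IsZero (HomologicalComplex.homology _ _) ↔ _
  rw [← HomologicalComplex.exactAt_iff_isZero_homology,
    HomologicalComplex.exactAt_iff' _ (n + 1 + 1) (n + 1) n (by simp) (by simp),
    ShortComplex.ShortExact.moduleCat_exact_iff_function_exact]
  rfl

end Tor

/-! ### Mon(B, A) as the B-projective modules. -/

section MonProjective

variable {k A B : Type u} [Field k] [Ring A] [Algebra k A] [Ring B] [Algebra k B]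

theorem IsSES.projective_resB {X Y Z : Type u} [AddCommGroup X] [Module (A ⊗[k] B) X]
    [AddCommGroup Y] [Module (A ⊗[k] B) Y] [AddCommGroup Z] [Module (A ⊗[k] B) Z]
    {f : X →ₗ[A ⊗[k] B] Y} {g : Y →ₗ[A ⊗[k] B] Z} (s : IsSES f g)
    [Module.Projective B (ResB k A B Y)] [Module.Projective B (ResB k A B Z)] :
    Module.Projective B (ResB k A B X) := by
  obtain ⟨ρ, hρ⟩ := (ExtVanish.of_projective (R := B) (G := ResB k A B Z)
    (N := ResB k A B X)).extend (s.resMap k A B) LinearMap.id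
  exact Module.Projective.of_split (MonRep.resMap k A B f) ρ (LinearMap.ext hρ)

section Resolution

variable {R : Type u} [Ring R] {X : ModuleCat.{u} R} (P : ProjectiveResolution X)

theorem resolution_exact_succ (n : ℕ) : Function.Exact (P.complex.d (n + 1 + 1) (n + 1)).hom
    (P.complex.d (n + 1) n).hom :=
  (ShortComplex.ShortExact.moduleCat_exact_iff_function_exact _).1 (P.exact_succ n)

/-- The augmentation of a projective resolution, as a linear map. -/
def augmentation : P.complex.X 0 →ₗ[R] X := (P.π.f 0).hom

theorem resolution_exact_zero : Function.Exact (P.complex.d 1 0).hom (augmentation P) :=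
  (ShortComplex.ShortExact.moduleCat_exact_iff_function_exact _).1 P.exact₀

theorem resolution_surjective : Function.Surjective (augmentation P) :=
  (ModuleCat.epi_iff_surjective _).1 inferInstance

instance (n : ℕ) : Module.Projective R (P.complex.X n) :=
  (IsProjective.iff_projective _).2 (P.projective n)

end Resolution

theorem exists_isSES_coker {R X Y Z : Type*} [Ring R] [AddCommGroup X] [Module R X]
    [AddCommGroup Y] [Module R Y] [AddCommGroup Z] [Module R Z] {f : X →ₗ[R] Y} {g : Y →ₗ[R] Z}
    (h : Function.Exact f g) : ∃ j : (Y ⧸ LinearMap.range f) →ₗ[R] Z,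
      IsSES j (LinearMap.range g).mkQ ∧ j ∘ₗ (LinearMap.range f).mkQ = g := by
  have hle : LinearMap.range f ≤ LinearMap.ker g := (LinearMap.exact_iff.1 h).ge
  refine ⟨(LinearMap.range f).liftQ g hle, ⟨?_, Submodule.mkQ_surjective _, ?_⟩,
    Submodule.liftQ_mkQ _ _ _⟩
  · rw [← LinearMap.ker_eq_bot, Submodule.ker_liftQ, LinearMap.exact_iff.1 h,
      Submodule.mkQ_map_self]
  · rw [LinearMap.exact_iff, Submodule.ker_mkQ, Submodule.range_liftQ]

/-- By induction along the resolution: each cokernel is the kernel of a surjection from a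
B-projective module onto the previous cokernel. -/
theorem projective_resB_coker {X : ModuleCat.{u} (A ⊗[k] B)}
    [Module.Projective B (ResB k A B X)] (P : ProjectiveResolution X) (n : ℕ) :
    Module.Projective B (ResB k A B
      (P.complex.X n ⧸ LinearMap.range (P.complex.d (n + 1) n).hom)) := by
  induction n with
  | zero =>
    let e := (resolution_exact_zero P).linearEquivOfSurjective (resolution_surjective P)
    exact Module.Projective.of_split (resMap k A B e.toLinearMap)
      (resMap k A B e.symm.toLinearMap) (LinearMap.ext e.symm_apply_apply)
  | succ n ih =>
    obtain ⟨j, hj, -⟩ := exists_isSES_coker (resolution_exact_succ P n)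
    exact hj.projective_resB

/-- Each differential factors as a cokernel map followed by an inclusion whose quotient is
B-projective. Tensoring keeps the former a cokernel and the latter injective. -/
theorem mon_of_projective_resB {X : ModuleCat.{u} (A ⊗[k] B)} [Module.Finite (A ⊗[k] B) X]
    [Module.Projective B (ResB k A B X)] : Mon k A B X := by
  refine ⟨inferInstance, fun S _ _ _ _ _ i hi => ?_⟩
  obtain ⟨n, rfl⟩ : ∃ n, i = n + 1 := ⟨i - 1, by omega⟩
  let P := projectiveResolution X
  rw [isZero_torModule_iff P]
  obtain ⟨j, hj, hjg⟩ := exists_isSES_coker (resolution_exact_succ P n)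
  have := projective_resB_coker P n
  have h1 := (hj.balancedMap (RightDual k S)).inj
  have h2 := balancedMap_exact (T := A) (M := Ind k A (RightDual k S))
    (Submodule.mkQ_surjective _)
    (LinearMap.exact_map_mkQ_range (P.complex.d (n + 1 + 1) (n + 1)).hom)
  rw [← hjg, balancedMap_comp]
  exact fun y => ⟨fun hy => (h2 y).1 (h1 (hy.trans (map_zero _).symm)),
    fun hy => (congrArg _ ((h2 y).2 hy)).trans (map_zero _)⟩

/-- If `Tor₁` vanishes, then the functor `(A ⊗ V) ⊗_Λ -` preserves the injectivity of the inclusion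
of a syzygy. -/
theorem balancedMap_injective_of_isZero_tor {T R M : Type u} [Ring T] [Ring R] [AddCommGroup M]
    [Module T M] [Module Rᵐᵒᵖ M] [SMulCommClass T Rᵐᵒᵖ M] {X : ModuleCat.{u} R}
    (P : ProjectiveResolution X) (h : Limits.IsZero (torModule T R M 1 X)) :
    Function.Injective (balancedMap T R M (LinearMap.ker (augmentation P)).subtype) := by
  have h1 := (isZero_torModule_iff P 0).1 h
  let c : P.complex.X 1 →ₗ[R] LinearMap.ker (augmentation P) :=
    (P.complex.d 1 0).hom.codRestrict _ fun x => (resolution_exact_zero P).apply_apply_eq_zero x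
  have hc : Function.Surjective c := by
    rintro ⟨x, hx⟩
    obtain ⟨y, rfl⟩ := (resolution_exact_zero P x).1 hx
    exact ⟨y, rfl⟩
  have hd : (LinearMap.ker (augmentation P)).subtype ∘ₗ c = (P.complex.d 1 0).hom := rfl
  have hcd : c ∘ₗ (P.complex.d 2 1).hom = 0 := LinearMap.ext fun x =>
    Subtype.ext ((resolution_exact_succ P 0).apply_apply_eq_zero x)
  rw [injective_iff_map_eq_zero]
  intro t ht
  obtain ⟨s, rfl⟩ := balancedMap_surjective (T := T) (M := M) hc t
  rw [← LinearMap.comp_apply, ← balancedMap_comp, hd] at ht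
  obtain ⟨r, rfl⟩ := (h1 s).1 ht
  have h0 : balancedMap T R M c ∘ₗ balancedMap T R M (P.complex.d 2 1).hom = 0 := by
    rw [← balancedMap_comp, hcd]
    exact balanced_hom_ext fun m x => by
      rw [balancedMap_mk, LinearMap.zero_apply, LinearMap.zero_apply, TensorProduct.tmul_zero,
        Submodule.Quotient.mk_zero]
  exact LinearMap.congr_fun h0 r

/-- If `(A ⊗ D(S)) ⊗_Λ f` is injective, then `B`-linear maps into `S` extend along `f`. -/
theorem exists_extend_of_balancedMap_injective {S : Type u} [AddCommGroup S] [Module k S]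
    [Module B S] [IsScalarTower k B S] [FiniteDimensional k S]
    {X Y : Type u} [AddCommGroup X] [Module (A ⊗[k] B) X] [AddCommGroup Y] [Module (A ⊗[k] B) Y]
    {f : X →ₗ[A ⊗[k] B] Y}
    (hf : Function.Injective (balancedMap A (A ⊗[k] B) (Ind k A (RightDual k S)) f))
    (w : ResB k A B X →ₗ[B] S) :
    ∃ v : ResB k A B Y →ₗ[B] S, ∀ x, v (resMap k A B f x) = w x := by
  let V := RightDual k S
  let _ : Module k (IndTensor k A B V X) := Module.compHom _ (algebraMap k A)
  let _ : Module k (IndTensor k A B V Y) := Module.compHom _ (algebraMap k A)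
  have hkX : ∀ (c : k) (t : IndTensor k A B V X), c • t = algebraMap k A c • t := fun _ _ => rfl
  have hkY : ∀ (c : k) (t : IndTensor k A B V Y), c • t = algebraMap k A c • t := fun _ _ => rfl
  let ev : V → S → k := fun φ s => (show S →ₗ[k] k from φ) s
  -- The map w is encoded as the functional φ ⊗ x ↦ φ(w x) on D(S) ⊗_B X.
  obtain ⟨Θ, hΘ⟩ := exists_indTensor_lift (k := k) (A := A) (B := B) (V := V) (X := X)
    (AddMonoidHom.mk' (fun φ => AddMonoidHom.mk' (M := X) (fun x => ev φ (w x))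
      fun x y => (congrArg (ev φ) (w.map_add x y)).trans
        ((show S →ₗ[k] k from φ).map_add (w x) (w y)))
      fun φ ψ => rfl) fun b φ x => (congrArg (ev φ) (w.map_smul b x)).symm
  have hΘ' : ∀ φ (x : X), Θ (tmk k A B φ x) = ev φ (w x) := hΘ
  let Θ' : IndTensor k A B V X →ₗ[k] k :=
    { Θ with
      map_smul' := fun c t => by
        change Θ (c • t) = c • Θ t
        rw [hkX]
        induction t using tmk_induction with
        | hmk φ x =>
          rw [← tmk_smul, hΘ', hΘ']
          rfl
        | hadd s t hs ht => rw [smul_add, map_add, map_add, smul_add, hs, ht]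
        | h0 => rw [smul_zero, map_zero, smul_zero] }
  let F : IndTensor k A B V X →ₗ[k] IndTensor k A B V Y :=
    { balancedMap A (A ⊗[k] B) (Ind k A V) f with
      map_smul' := fun c t => map_smul (balancedMap A (A ⊗[k] B) (Ind k A V) f) _ t }
  obtain ⟨G, hG⟩ := F.exists_leftInverse_of_injective (LinearMap.ker_eq_bot.2 hf)
  have hGF : ∀ φ (x : X), Θ' (G (tmk k A B φ (f x))) = ev φ (w x) := fun φ x => by
    have h1 : F (tmk k A B φ x) = tmk k A B φ (f x) := balancedMap_tmk f φ x
    rw [← h1]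
    exact (congrArg Θ' (LinearMap.congr_fun hG (tmk k A B φ x))).trans (hΘ' φ x)
  -- Composing with a k-linear retraction G of the injective map extends the functional to D(S) ⊗_B
  -- Y. It is read back as a map into the double dual of S, which is S.
  let H : Y → Module.Dual k (Module.Dual k S) := fun y =>
    { toFun := fun φ => Θ' (G (tmk k A B (show V from φ) y))
      map_add' := fun φ ψ => by
        refine Eq.trans ?_ (map_add (Θ' ∘ₗ G) _ _)
        exact congrArg (Θ' ∘ₗ G) (tmk_add_left (V := V) k φ ψ y)
      map_smul' := fun c φ => by
        refine Eq.trans ?_ (map_smul (Θ' ∘ₗ G) c _)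
        exact congrArg (Θ' ∘ₗ G) (tmk_smul (V := V) k c φ y) }
  have hHadd : ∀ x y, H (x + y) = H x + H y := fun x y => LinearMap.ext fun φ => by
    refine Eq.trans ?_ (map_add (Θ' ∘ₗ G) _ _)
    exact congrArg (Θ' ∘ₗ G) (tmk_add_right (V := V) k φ x y)
  have hinj : ∀ s t : S, (∀ φ : S →ₗ[k] k, φ s = φ t) → s = t := fun s t h =>
    (Module.evalEquiv k S).injective (LinearMap.ext h)
  have hev : ∀ (h : Module.Dual k (Module.Dual k S)) (φ : S →ₗ[k] k),
      φ ((Module.evalEquiv k S).symm h) = h φ := fun h φ =>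
    LinearMap.congr_fun ((Module.evalEquiv k S).apply_symm_apply h) φ
  refine ⟨{ toFun := fun y => (Module.evalEquiv k S).symm (H y), map_add' := fun x y => ?_,
            map_smul' := fun b y => ?_ }, fun x => ?_⟩
  · exact (congrArg _ (hHadd x y)).trans (map_add _ _ _)
  · refine hinj _ _ fun φ => (hev _ φ).trans ?_
    refine (congrArg (Θ' ∘ₗ G) (tmk_op_smul (V := V) (X := Y) k b φ y)).symm.trans ?_
    exact (hev (H y) (φ ∘ₗ Algebra.lsmul k k S b)).symm
  · exact hinj _ _ fun φ => (hev _ φ).trans (hGF φ x)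

/-- B-linear maps from X to simple modules extend to Y, so Ext¹_B(Z, S) = 0 for every simple S. By
finite length Ext¹_B(Z, -) vanishes on all finitely generated modules, and Z is finitely generated
over B. -/
theorem projective_resB_of_balancedMap_injective [FiniteDimensional k A] [FiniteDimensional k B]
    {X Y Z : Type u} [AddCommGroup X] [Module (A ⊗[k] B) X] [AddCommGroup Y]
    [Module (A ⊗[k] B) Y] [AddCommGroup Z] [Module (A ⊗[k] B) Z] [Module.Finite (A ⊗[k] B) Z]
    [Module.Projective B (ResB k A B Y)] {f : X →ₗ[A ⊗[k] B] Y} {g : Y →ₗ[A ⊗[k] B] Z}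
    (s : IsSES f g)
    (h : ∀ (S : Type u) [AddCommGroup S] [Module k S] [Module B S] [IsScalarTower k B S]
      [IsSimpleModule B S] [FiniteDimensional k S],
      Function.Injective (balancedMap A (A ⊗[k] B) (Ind k A (RightDual k S)) f)) :
    Module.Projective B (ResB k A B Z) := by
  have : IsNoetherianRing B := IsNoetherianRing.of_finite k B
  have : IsArtinianRing B := IsArtinianRing.of_finite k B
  refine projective_of_extVanish fun N _ _ _ => ExtVanish.of_isFiniteLength (fun S _ _ _ => ?_)
    (isFiniteLength_iff_isNoetherian_isArtinian.2 ⟨inferInstance, inferInstance⟩)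
  let _ : Module k S := Module.compHom S (algebraMap k B)
  have : IsScalarTower k B S := ⟨fun c b s => by
    change (c • b) • s = algebraMap k B c • b • s
    rw [smul_smul, Algebra.smul_def]⟩
  have : FiniteDimensional k S := Module.Finite.trans B S
  exact ExtVanish.of_presentation (s.resMap k A B) fun w =>
    exists_extend_of_balancedMap_injective (h S) w

theorem projective_resB_of_mon [FiniteDimensional k A] [FiniteDimensional k B]
    {X : ModuleCat.{u} (A ⊗[k] B)} (h : Mon k A B X) : Module.Projective B (ResB k A B X) :=
  have := h.1
  projective_resB_of_balancedMap_injective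
    (isSES_ker (resolution_surjective (projectiveResolution X)))
    -- Only Tor₁ is needed in this direction.
    fun S _ _ _ _ _ _ => balancedMap_injective_of_isZero_tor _ (h.2 S 1 le_rfl)

/-- The monomorphism category consists of the finitely generated modules that are projective over
`B`. -/
theorem mon_iff [FiniteDimensional k A] [FiniteDimensional k B] {X : ModuleCat.{u} (A ⊗[k] B)} :
    Mon k A B X ↔ Module.Finite (A ⊗[k] B) X ∧ Module.Projective B (ResB k A B X) :=
  ⟨fun h => ⟨h.1, projective_resB_of_mon h⟩, fun ⟨_, _⟩ => mon_of_projective_resB⟩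

end MonProjective

/-! ### Short exact sequences as short complexes. -/

section Conflations

variable {R : Type u} [Ring R]

theorem isSES_of_shortExact {S : ShortComplex (ModuleCat.{u} R)} (h : S.ShortExact) :
    IsSES S.f.hom S.g.hom :=
  ⟨(ModuleCat.mono_iff_injective _).1 h.mono_f, (ModuleCat.epi_iff_surjective _).1 h.epi_g,
    (ShortComplex.ShortExact.moduleCat_exact_iff_function_exact S).1 h.exact⟩

/-- A short exact sequence of modules as a short complex. -/
def IsSES.shortComplex {X Y Z : ModuleCat.{u} R} {f : X →ₗ[R] Y} {g : Y →ₗ[R] Z} (s : IsSES f g) :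
    ShortComplex (ModuleCat.{u} R) :=
  ShortComplex.mk (ModuleCat.ofHom f) (ModuleCat.ofHom g) (by ext x; exact s.comp_apply x)

theorem IsSES.shortExact {X Y Z : ModuleCat.{u} R} {f : X →ₗ[R] Y} {g : Y →ₗ[R] Z}
    (s : IsSES f g) : s.shortComplex.ShortExact := by
  have : Mono s.shortComplex.f := (ModuleCat.mono_iff_injective _).2 s.inj
  have : Epi s.shortComplex.g := (ModuleCat.epi_iff_surjective _).2 s.surj
  exact ⟨(ShortComplex.ShortExact.moduleCat_exact_iff_function_exact _).2 s.exact⟩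

theorem IsSES.finite {X Y Z : Type*} [AddCommGroup X] [Module R X] [AddCommGroup Y] [Module R Y]
    [AddCommGroup Z] [Module R Z] {f : X →ₗ[R] Y} {g : Y →ₗ[R] Z} (s : IsSES f g)
    [Module.Finite R X] [Module.Finite R Z] : Module.Finite R Y := by
  refine ⟨Submodule.fg_of_fg_map_of_fg_inf_ker g ?_ ?_⟩
  · rw [Submodule.map_top, LinearMap.range_eq_top.2 s.surj]
    exact Module.Finite.fg_top
  · rw [top_inf_eq, LinearMap.exact_iff.1 s.exact, LinearMap.range_eq_map]
    exact Module.Finite.fg_top.map f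

end Conflations

/-! ### Closure properties and Ext-vanishing in Mon(B, A-Gproj). -/

section MonGproj

variable {k A B : Type u} [Field k] [Ring A] [Algebra k A] [FiniteDimensional k A] [Ring B]
  [Algebra k B] [FiniteDimensional k B]

theorem isNoetherianRing_tensor : IsNoetherianRing (A ⊗[k] B) := IsNoetherianRing.of_finite k _

omit [FiniteDimensional k A] in
theorem finiteDimensional_of_op {V : Type u} [AddCommGroup V] [Module k V] [Module Bᵐᵒᵖ V]
    [IsScalarTower k Bᵐᵒᵖ V] [Module.Finite Bᵐᵒᵖ V] : FiniteDimensional k V :=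
  Module.Finite.trans Bᵐᵒᵖ V

omit [FiniteDimensional k A] [FiniteDimensional k B] in
theorem mon_of_projective {X : ModuleCat.{u} (A ⊗[k] B)} [Module.Finite (A ⊗[k] B) X]
    [Module.Projective (A ⊗[k] B) X] : Mon k A B X :=
  mon_of_projective_resB

theorem monIn_of_projective {X : ModuleCat.{u} (A ⊗[k] B)} [Module.Finite (A ⊗[k] B) X]
    [Module.Projective (A ⊗[k] B) X] : MonIn k A B (Gproj A) X := by
  refine ⟨mon_of_projective, fun V _ _ _ _ _ => ?_⟩
  have : FiniteDimensional k V := finiteDimensional_of_op (B := B)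
  exact Gproj.of_projective (P := ModuleCat.of A (IndTensor k A B V X))

theorem Mon.extension {X Y Z : ModuleCat.{u} (A ⊗[k] B)} {f : X →ₗ[A ⊗[k] B] Y}
    {g : Y →ₗ[A ⊗[k] B] Z} (s : IsSES f g) (hX : Mon k A B X) (hZ : Mon k A B Z) :
    Mon k A B Y := by
  rw [mon_iff] at *
  obtain ⟨_, _⟩ := hX
  obtain ⟨_, _⟩ := hZ
  refine ⟨s.finite, ?_⟩
  obtain ⟨ρ, hρ⟩ := (ExtVanish.of_projective (R := B) (G := ResB k A B Z)
    (N := ResB k A B X)).extend (s.resMap k A B) LinearMap.id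
  exact Module.Projective.of_equiv' ((s.resMap k A B).prodEquiv ρ hρ).symm

theorem Mon.syzygy {X Y Z : ModuleCat.{u} (A ⊗[k] B)} {f : X →ₗ[A ⊗[k] B] Y}
    {g : Y →ₗ[A ⊗[k] B] Z} (s : IsSES f g) (hY : Mon k A B Y) (hZ : Mon k A B Z) :
    Mon k A B X := by
  rw [mon_iff] at *
  obtain ⟨_, _⟩ := hY
  obtain ⟨_, _⟩ := hZ
  have := isNoetherianRing_tensor (k := k) (A := A) (B := B)
  exact ⟨Module.Finite.of_injective f s.inj, s.projective_resB⟩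

theorem MonIn.extension {X Y Z : ModuleCat.{u} (A ⊗[k] B)} {f : X →ₗ[A ⊗[k] B] Y}
    {g : Y →ₗ[A ⊗[k] B] Z} (s : IsSES f g) (hX : MonIn k A B (Gproj A) X)
    (hZ : MonIn k A B (Gproj A) Z) : MonIn k A B (Gproj A) Y := by
  refine ⟨Mon.extension s hX.1 hZ.1, fun V _ _ _ _ _ => ?_⟩
  have := projective_resB_of_mon hZ.1
  exact Gproj.extension (G := ModuleCat.of A (IndTensor k A B V Y)) (s.balancedMap V)
    (hX.2 V) (hZ.2 V)

theorem MonIn.syzygy {X P Z : ModuleCat.{u} (A ⊗[k] B)} [Module.Finite (A ⊗[k] B) P]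
    [Module.Projective (A ⊗[k] B) P] {f : X →ₗ[A ⊗[k] B] P} {g : P →ₗ[A ⊗[k] B] Z}
    (s : IsSES f g) (hZ : MonIn k A B (Gproj A) Z) : MonIn k A B (Gproj A) X := by
  refine ⟨Mon.syzygy s mon_of_projective hZ.1, fun V _ _ _ _ _ => ?_⟩
  have := projective_resB_of_mon hZ.1
  have : FiniteDimensional k V := finiteDimensional_of_op (B := B)
  exact Gproj.syzygy (P := ModuleCat.of A (IndTensor k A B V P))
    (K := ModuleCat.of A (IndTensor k A B V X)) (s.balancedMap V) (hZ.2 V)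

/-- By adjunction, extending a map into Hom_k(V, A) is extending its adjoint into A. The latter is
possible because T_V is exact here and Ext¹_A(T_V X, A) = 0. -/
theorem MonIn.extVanish_coind {X : ModuleCat.{u} (A ⊗[k] B)} (hX : MonIn k A B (Gproj A) X)
    (V : Type u) [AddCommGroup V] [Module k V] [Module Bᵐᵒᵖ V] [IsScalarTower k Bᵐᵒᵖ V]
    [Module.Finite Bᵐᵒᵖ V] : ExtVanish (A ⊗[k] B) X (Coind k V A) := by
  intro Y _ _ g hg f
  have := projective_resB_of_mon hX.1
  obtain ⟨F, hF⟩ := exists_indTensor_of_coind f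
  obtain ⟨G, hG⟩ := (hX.2 V).extVanish.extend ((isSES_ker hg).balancedMap V) F
  obtain ⟨h, hh⟩ := exists_coind_of_indTensor G
  refine ⟨h, fun x => coind_ext fun v => ?_⟩
  rw [hh, ← hF, ← hG, balancedMap_tmk]
  rfl

theorem MonIn.extVanish_projective {X : ModuleCat.{u} (A ⊗[k] B)} (hX : MonIn k A B (Gproj A) X)
    (P : Type u) [AddCommGroup P] [Module (A ⊗[k] B) P] [Module.Finite (A ⊗[k] B) P]
    [Module.Projective (A ⊗[k] B) P] : ExtVanish (A ⊗[k] B) X P := by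
  have h : ExtVanish (A ⊗[k] B) X (A ⊗[k] B) :=
    (hX.extVanish_coind (RightDual k B)).retract_right (i := (coindDualSelfEquiv k A B).toLinearMap)
      (r := (coindDualSelfEquiv k A B).symm.toLinearMap) (by simp)
  exact h.finite_projective

omit [FiniteDimensional k A] [FiniteDimensional k B] in
variable (k A B) in
theorem exists_isSES_coind {V V' W : Type u} [AddCommGroup V] [Module k V] [Module Bᵐᵒᵖ V]
    [IsScalarTower k Bᵐᵒᵖ V] [AddCommGroup V'] [Module k V'] [Module Bᵐᵒᵖ V']
    [IsScalarTower k Bᵐᵒᵖ V'] [AddCommGroup W] [Module k W] [Module Bᵐᵒᵖ W]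
    [IsScalarTower k Bᵐᵒᵖ W] {i : V →ₗ[Bᵐᵒᵖ] V'} {p : V' →ₗ[Bᵐᵒᵖ] W} (s : IsSES i p) :
    ∃ (F : Coind k W A →ₗ[A ⊗[k] B] Coind k V' A) (G : Coind k V' A →ₗ[A ⊗[k] B] Coind k V A),
      IsSES F G ∧ ∀ h v, G h v = h (i v) := by
  obtain ⟨F, hF⟩ := exists_coind_map_left (k := k) (A := A) (N := A) p
  obtain ⟨G, hG⟩ := exists_coind_map_left (k := k) (A := A) (N := A) i
  refine ⟨F, G, ⟨fun g h hgh => coind_ext fun w => ?_, fun h => ?_, fun h => ⟨fun hh => ?_, ?_⟩⟩,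
    hG⟩
  · obtain ⟨v, rfl⟩ := s.surj w
    rw [← hF, ← hF, hgh]
  · obtain ⟨r, hr⟩ := (i.restrictScalars k).exists_leftInverse_of_injective
      (LinearMap.ker_eq_bot.2 s.inj)
    refine ⟨(show V →ₗ[k] A from h) ∘ₗ r, coind_ext fun v => ?_⟩
    exact (hG _ v).trans (congrArg h (LinearMap.congr_fun hr v))
  · obtain ⟨t, ht⟩ := exists_factor_of_surjective (R := k) (g := p.restrictScalars k) s.surj
      (show V' →ₗ[k] A from h) (fun v hv => by
        obtain ⟨w, rfl⟩ := (s.exact v).1 hv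
        exact (hG h w).symm.trans (DFunLike.congr_fun hh w))
    exact ⟨t, coind_ext fun v => (hF t v).trans (ht v)⟩
  · rintro ⟨g, rfl⟩
    refine coind_ext fun v => ?_
    rw [hG, hF, s.comp_apply]
    exact map_zero g

omit [FiniteDimensional k B] in
/-- A finitely generated right module embeds into a finite power of `D(B)`. -/
theorem exists_injective_pi_rightDual (V : Type u) [AddCommGroup V] [Module k V] [Module Bᵐᵒᵖ V]
    [IsScalarTower k Bᵐᵒᵖ V] [FiniteDimensional k V] :
    ∃ (m : ℕ) (i : V →ₗ[Bᵐᵒᵖ] (Fin m → RightDual k B)), Function.Injective i := by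
  let β := Module.finBasis k V
  -- The j-th component sends v to the functional b ↦ β_j(v b); evaluating at b = 1 recovers the
  -- coordinates of v.
  let i : V →ₗ[Bᵐᵒᵖ] (Fin (Module.finrank k V) → RightDual k B) :=
    { toFun := fun v j => ((β.coord j) ∘ₗ (LinearMap.toSpanSingleton Bᵐᵒᵖ V v).restrictScalars k ∘ₗ
        (MulOpposite.opLinearEquiv k).toLinearMap : B →ₗ[k] k)
      map_add' := fun v w => by
        refine funext fun j => (LinearMap.ext fun b => ?_ : (_ : B →ₗ[k] k) = _)
        change β.coord j (MulOpposite.op b • (v + w)) = 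
          β.coord j (MulOpposite.op b • v) + β.coord j (MulOpposite.op b • w)
        rw [smul_add, map_add]
      map_smul' := fun b v => by
        refine funext fun j => (LinearMap.ext fun c => ?_ : (_ : B →ₗ[k] k) = _)
        change β.coord j (MulOpposite.op c • b • v) = β.coord j (MulOpposite.op (b.unop * c) • v)
        rw [smul_smul]
        rfl }
  refine ⟨_, i, fun v w h => β.ext_elem fun j => ?_⟩
  have : β.coord j (MulOpposite.op (1 : B) • v) = β.coord j (MulOpposite.op (1 : B) • w) :=
    LinearMap.congr_fun (congrFun h j) (1 : B)
  simpa using this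

end MonGproj

/-! ### Left approximations by projectives, and cosyzygies. -/

section Approximation

variable {k A B : Type u} [Field k] [Ring A] [Algebra k A] [FiniteDimensional k A] [Ring B]
  [Algebra k B] [FiniteDimensional k B]

-- The map f is adjoint to an embedding of T_{D(B)} X into Aⁿ with Gorenstein projective quotient up
-- to a projective retraction; functionals on T_{D(B)} X therefore factor through Aⁿ.
omit [FiniteDimensional k A] in
theorem MonIn.exists_approximation {X : ModuleCat.{u} (A ⊗[k] B)}
    (hX : MonIn k A B (Gproj A) X) :
    ∃ (n : ℕ) (f : X →ₗ[A ⊗[k] B] (Fin n → Coind k (RightDual k B) A)),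
      ∀ w : X →ₗ[A ⊗[k] B] Coind k (RightDual k B) A,
        ∃ v : (Fin n → Coind k (RightDual k B) A) →ₗ[A ⊗[k] B] Coind k (RightDual k B) A,
          ∀ x, v (f x) = w x := by
  obtain ⟨-, ⟨C, hC, P, i, p, _, _, s⟩, -⟩ := isGorensteinClass_gproj _ (hX.2 (RightDual k B))
  obtain ⟨n, j, r, hjr⟩ := exists_retract_pi (R := A) (N := P)
  have hfac : ∀ w : IndTensor k A B (RightDual k B) X →ₗ[A] A, ∃ v : (Fin n → A) →ₗ[A] A,
      ∀ t, v (j (i t)) = w t := fun w => by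
    obtain ⟨v, hv⟩ := hC.extVanish.extend s w
    exact ⟨v ∘ₗ r, fun t => by rw [LinearMap.comp_apply, hjr]; exact hv t⟩
  choose f hf using fun l : Fin n => exists_coind_of_indTensor (k := k) (B := B)
    (V := RightDual k B) (X := X) (LinearMap.proj l ∘ₗ j ∘ₗ i)
  refine ⟨n, LinearMap.pi f, fun w => ?_⟩
  obtain ⟨W, hW⟩ := exists_indTensor_of_coind w
  obtain ⟨v, hv⟩ := hfac W
  choose F hF using fun l : Fin n => exists_coind_map_right (k := k) (B := B) (V := RightDual k B)
    (LinearMap.toSpanSingleton A A (v (Pi.single l 1)))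
  -- A functional on Aⁿ is a sum of right multiplications by its values on the basis vectors, and
  -- each of these coinduces to a Λ-linear map.
  refine ⟨∑ l, F l ∘ₗ LinearMap.proj l, fun x => coind_ext fun φ => ?_⟩
  have hsum : ∀ (g : Fin n → Coind k (RightDual k B) A), (∑ l, g l) φ = ∑ l, g l φ := fun g =>
    LinearMap.sum_apply Finset.univ (fun l => (show RightDual k B →ₗ[k] A from g l)) φ
  rw [LinearMap.sum_apply, hsum, ← hW]
  refine Eq.trans ?_ (hv (tmk k A B φ x))
  rw [LinearMap.pi_apply_eq_sum_univ v (j (i (tmk k A B φ x)))]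
  refine Finset.sum_congr rfl fun l _ => ?_
  have : (fun a => if l = a then (1 : A) else 0) = Pi.single l 1 := by
    ext a
    simp [Pi.single_apply, eq_comm]
  rw [LinearMap.comp_apply, hF, LinearMap.toSpanSingleton_apply, this]
  congr 1
  exact hf l x φ

/-- A map through which all maps to `Hom_k(D(B), A)` factor becomes a left approximation after
applying `(A ⊗ V) ⊗_Λ -`. -/
theorem MonIn.exists_factor_indTensor {X : ModuleCat.{u} (A ⊗[k] B)}
    (hX : MonIn k A B (Gproj A) X) {Q : Type u} [AddCommGroup Q] [Module (A ⊗[k] B) Q]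
    {f : X →ₗ[A ⊗[k] B] Q} (hf : ∀ w : X →ₗ[A ⊗[k] B] Coind k (RightDual k B) A,
      ∃ v : Q →ₗ[A ⊗[k] B] Coind k (RightDual k B) A, ∀ x, v (f x) = w x)
    (V : Type u) [AddCommGroup V] [Module k V] [Module Bᵐᵒᵖ V] [IsScalarTower k Bᵐᵒᵖ V]
    [FiniteDimensional k V] (w : IndTensor k A B V X →ₗ[A] A) :
    ∃ v : IndTensor k A B V Q →ₗ[A] A, ∀ x,
      v (balancedMap A (A ⊗[k] B) (Ind k A V) f x) = w x := by
  obtain ⟨m, i, hi⟩ := exists_injective_pi_rightDual (k := k) (B := B) V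
  obtain ⟨F, G, s, hG⟩ := exists_isSES_coind k A B (isSES_range hi)
  obtain ⟨w', hw'⟩ := exists_coind_of_indTensor w
  -- The obstruction to lifting along the restriction Hom_k(D(B)ᵐ, A) → Hom_k(V, A) lies in Ext¹ of
  -- X into the coinduced module of the cokernel of i, and so vanishes. The lift then factors
  -- through f componentwise.
  obtain ⟨l, hl⟩ := (hX.extVanish_coind _).lift s w'
  choose L hL using fun c : Fin m => exists_coind_map_left (k := k) (A := A) (N := A)
    (LinearMap.single Bᵐᵒᵖ (fun _ : Fin m => RightDual k B) c)
  choose J hJ using fun c : Fin m => exists_coind_map_left (k := k) (A := A) (N := A)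
    (LinearMap.proj c : (Fin m → RightDual k B) →ₗ[Bᵐᵒᵖ] RightDual k B)
  choose v hv using fun c : Fin m => hf (L c ∘ₗ l)
  have key : ∀ x, (∑ c, J c ∘ₗ v c) (f x) = l x := fun x => coind_ext fun ψ => by
    have hsum : ∀ (g : Fin m → Coind k (Fin m → RightDual k B) A), (∑ c, g c) ψ = ∑ c, g c ψ :=
      fun g => LinearMap.sum_apply Finset.univ
        (fun c => (show (Fin m → RightDual k B) →ₗ[k] A from g c)) ψ
    rw [LinearMap.sum_apply, hsum]
    conv_rhs => rw [← Finset.univ_sum_single ψ, map_sum]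
    refine Finset.sum_congr rfl fun c _ => ?_
    rw [LinearMap.comp_apply, hJ, hv, LinearMap.comp_apply, hL]
    rfl
  obtain ⟨t, ht⟩ := exists_indTensor_of_coind (G ∘ₗ ∑ c, J c ∘ₗ v c)
  refine ⟨t, fun x => ?_⟩
  have : t ∘ₗ balancedMap A (A ⊗[k] B) (Ind k A V) f = w := indTensor_hom_ext fun v x => by
    rw [LinearMap.comp_apply, balancedMap_tmk, ht, LinearMap.comp_apply, key, hl, hw']
  exact LinearMap.congr_fun this x

-- The action map B ⊗_B X → X recovers x from 1 ⊗ x.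
omit [FiniteDimensional k A] [FiniteDimensional k B] in
theorem injective_of_balancedMap_injective {X Y : Type u} [AddCommGroup X] [Module (A ⊗[k] B) X]
    [AddCommGroup Y] [Module (A ⊗[k] B) Y] {f : X →ₗ[A ⊗[k] B] Y}
    (hf : Function.Injective (balancedMap A (A ⊗[k] B) (Ind k A B) f)) :
    Function.Injective f := by
  obtain ⟨F, hF⟩ := exists_indTensor_lift (k := k) (A := A) (B := B) (V := B) (X := X)
    (AddMonoidHom.mk' (fun b => DistribSMul.toAddMonoidHom X ((1 : A) ⊗ₜ[k] b))
      (fun b c => by ext x; simp [TensorProduct.tmul_add, add_smul]))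
    (fun b v x => by
      simp [smul_smul])
  have hF : ∀ x : X, F (tmk k A B (1 : B) x) = x := fun x => by
    rw [hF]
    change ((1 : A) ⊗ₜ[k] (1 : B)) • x = x
    rw [← Algebra.TensorProduct.one_def, one_smul]
  intro x y hxy
  have : tmk k A B (1 : B) x = tmk k A B (1 : B) y := hf (by
    rw [balancedMap_tmk, balancedMap_tmk, hxy])
  rw [← hF x, this, hF]

/-- T_V of the approximation is again a left approximation for every finitely generated V, so it is
injective with Gorenstein projective cokernel. V = B makes f injective, V = D(S) puts the cokernel
of f in Mon(B, A), and general V puts it in Mon(B, A-Gproj). -/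
theorem MonIn.exists_cosyzygy {X : ModuleCat.{u} (A ⊗[k] B)} (hX : MonIn k A B (Gproj A) X) :
    ∃ (P Y : ModuleCat.{u} (A ⊗[k] B)) (f : X →ₗ[A ⊗[k] B] P) (g : P →ₗ[A ⊗[k] B] Y),
      Module.Finite (A ⊗[k] B) P ∧ Module.Projective (A ⊗[k] B) P ∧ IsSES f g ∧
        MonIn k A B (Gproj A) Y := by
  obtain ⟨n, f, hf⟩ := hX.exists_approximation
  have hproj : Module.Projective (A ⊗[k] B) (Fin n → Coind k (RightDual k B) A) :=
    Module.Projective.of_equiv' (LinearEquiv.piCongrRight fun _ => coindDualSelfEquiv k A B)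
  have hV : ∀ (V : Type u) [AddCommGroup V] [Module k V] [Module Bᵐᵒᵖ V] [IsScalarTower k Bᵐᵒᵖ V]
      [Module.Finite Bᵐᵒᵖ V], Function.Injective (balancedMap A (A ⊗[k] B) (Ind k A V) f) ∧
        Gproj A (ModuleCat.of A (IndTensor k A B V (Fin n → Coind k (RightDual k B) A) ⧸
          LinearMap.range (balancedMap A (A ⊗[k] B) (Ind k A V) f))) := by
    intro V _ _ _ _ _
    have : FiniteDimensional k V := finiteDimensional_of_op (B := B)
    exact Gproj.approximation (P := ModuleCat.of A (IndTensor k A B V _)) (hX.2 V)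
      (balancedMap A (A ⊗[k] B) (Ind k A V) f) (hX.exists_factor_indTensor hf V)
  have : Module.Finite Bᵐᵒᵖ B := Module.Finite.of_restrictScalars_finite k _ _
  have hinj : Function.Injective f := injective_of_balancedMap_injective (hV B).1
  have s := isSES_range hinj
  refine ⟨ModuleCat.of _ (Fin n → Coind k (RightDual k B) A),
    ModuleCat.of _ (_ ⧸ LinearMap.range f),
    f, (LinearMap.range f).mkQ, inferInstanceAs (Module.Finite _ (Fin n → _)), hproj, s,
    mon_iff.2 ⟨inferInstanceAs (Module.Finite _ (_ ⧸ LinearMap.range f)),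
      projective_resB_of_balancedMap_injective s fun S _ _ _ _ _ _ => ?_⟩, fun V _ _ _ _ _ => ?_⟩
  · have : FiniteDimensional k (RightDual k S) := inferInstanceAs (FiniteDimensional k (S →ₗ[k] k))
    have : Module.Finite Bᵐᵒᵖ (RightDual k S) := Module.Finite.of_restrictScalars_finite k _ _
    exact (hV (RightDual k S)).1
  · exact (hV V).2.congr (G' := ModuleCat.of A (IndTensor k A B V (_ ⧸ LinearMap.range f)))
      ((balancedMap_exact s.surj s.exact).linearEquivOfSurjective (balancedMap_surjective s.surj))

end Approximation

/-! ### The Frobenius structure on Mon(B, A-Gproj). -/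

section Frobenius

variable (k A B : Type u) [Field k] [Ring A] [Algebra k A] [FiniteDimensional k A] [Ring B]
  [Algebra k B] [FiniteDimensional k B]

theorem isProjObj_of_projective {R : Type u} [Ring R] {L : ObjectProperty (ModuleCat.{u} R)}
    {P : ModuleCat.{u} R} [Module.Projective R P] (h : L P) : IsProjObj L P := by
  refine ⟨h, fun S hS f => ?_⟩
  obtain ⟨g, hg⟩ := Module.projective_lifting_property S.g.hom f.hom (isSES_of_shortExact hS.1).surj
  exact ⟨ModuleCat.ofHom g, ModuleCat.hom_ext hg⟩

variable {k A B}

theorem MonIn.isInjObj_of_projective {P : ModuleCat.{u} (A ⊗[k] B)} [Module.Finite (A ⊗[k] B) P]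
    [Module.Projective (A ⊗[k] B) P] : IsInjObj (MonIn k A B (Gproj A)) P := by
  refine ⟨monIn_of_projective, fun S hS f => ?_⟩
  obtain ⟨g, hg⟩ := (MonIn.extVanish_projective hS.2.2.2 P).extend (isSES_of_shortExact hS.1) f.hom
  exact ⟨ModuleCat.ofHom g, ModuleCat.hom_ext (LinearMap.ext hg)⟩

theorem MonIn.exists_conflation_projective {X : ModuleCat.{u} (A ⊗[k] B)}
    (hX : MonIn k A B (Gproj A) X) : ∃ S : ShortComplex (ModuleCat.{u} (A ⊗[k] B)),
      Conflation (MonIn k A B (Gproj A)) S ∧ (Module.Finite (A ⊗[k] B) S.X₂ ∧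
        Module.Projective (A ⊗[k] B) S.X₂) ∧ S.X₃ = X := by
  have := hX.1.1
  obtain ⟨n, p, hp⟩ := Module.Finite.exists_fin' (A ⊗[k] B) X
  let P := ModuleCat.of (A ⊗[k] B) (Fin n → A ⊗[k] B)
  have hfin : Module.Finite (A ⊗[k] B) P :=
    inferInstanceAs (Module.Finite (A ⊗[k] B) (Fin n → A ⊗[k] B))
  have hproj : Module.Projective (A ⊗[k] B) P :=
    inferInstanceAs (Module.Projective (A ⊗[k] B) (Fin n → A ⊗[k] B))
  let K := ModuleCat.of (A ⊗[k] B) (LinearMap.ker p)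
  have s : IsSES (X := K) (Y := P) (Z := X) (LinearMap.ker p).subtype p := isSES_ker hp
  exact ⟨IsSES.shortComplex (X := K) (Y := P) s, ⟨IsSES.shortExact (X := K) (Y := P) s,
    MonIn.syzygy (X := K) (P := P) s hX, monIn_of_projective (X := P), hX⟩, ⟨hfin, hproj⟩, rfl⟩

theorem MonIn.exists_conflation_injective {X : ModuleCat.{u} (A ⊗[k] B)}
    (hX : MonIn k A B (Gproj A) X) : ∃ S : ShortComplex (ModuleCat.{u} (A ⊗[k] B)),
      Conflation (MonIn k A B (Gproj A)) S ∧ (Module.Finite (A ⊗[k] B) S.X₂ ∧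
        Module.Projective (A ⊗[k] B) S.X₂) ∧ S.X₁ = X := by
  obtain ⟨P, Y, f, g, h1, h2, s, hY⟩ := hX.exists_cosyzygy
  exact ⟨s.shortComplex, ⟨s.shortExact, hX, monIn_of_projective (X := P), hY⟩, ⟨h1, h2⟩, rfl⟩

theorem MonIn.isProjObj_iff {U : ModuleCat.{u} (A ⊗[k] B)} :
    IsProjObj (MonIn k A B (Gproj A)) U ↔
      Module.Finite (A ⊗[k] B) U ∧ Module.Projective (A ⊗[k] B) U := by
  refine ⟨fun h => ⟨h.1.1.1, ?_⟩, fun ⟨_, _⟩ => isProjObj_of_projective monIn_of_projective⟩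
  obtain ⟨S, hS, ⟨_, _⟩, rfl⟩ := MonIn.exists_conflation_projective h.1
  obtain ⟨g, hg⟩ := h.2 S hS (𝟙 _)
  exact Module.Projective.of_split g.hom S.g.hom (congrArg ModuleCat.Hom.hom hg)

/-- An injective object splits off the projective middle term of the conflation supplied by its
cosyzygy. -/
theorem MonIn.isInjObj_iff {U : ModuleCat.{u} (A ⊗[k] B)} :
    IsInjObj (MonIn k A B (Gproj A)) U ↔
      Module.Finite (A ⊗[k] B) U ∧ Module.Projective (A ⊗[k] B) U := by
  refine ⟨fun h => ⟨h.1.1.1, ?_⟩, fun ⟨_, _⟩ => MonIn.isInjObj_of_projective⟩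
  obtain ⟨S, hS, ⟨_, _⟩, rfl⟩ := MonIn.exists_conflation_injective h.1
  obtain ⟨g, hg⟩ := h.2 S hS (𝟙 _)
  exact Module.Projective.of_split S.f.hom g.hom (congrArg ModuleCat.Hom.hom hg)

variable (k A B) in
/-- `Mon(B, A-Gproj)` is a Frobenius exact category. -/
theorem isFrobeniusExact_monIn : IsFrobeniusExact (MonIn k A B (Gproj A)) where
  containsZero := ⟨ModuleCat.of _ PUnit, ModuleCat.isZero_of_subsingleton _,
    monIn_of_projective (X := ModuleCat.of _ PUnit)⟩
  closedUnderExtensions := ⟨fun hS h₁ h₃ => MonIn.extension (isSES_of_shortExact hS) h₁ h₃⟩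
  enoughProjectives X hX := by
    obtain ⟨S, hS, h, rfl⟩ := MonIn.exists_conflation_projective hX
    exact ⟨S, hS, MonIn.isProjObj_iff.2 h, ⟨Iso.refl _⟩⟩
  enoughInjectives X hX := by
    obtain ⟨S, hS, h, rfl⟩ := MonIn.exists_conflation_injective hX
    exact ⟨S, hS, MonIn.isInjObj_iff.2 h, ⟨Iso.refl _⟩⟩
  proj_iff_inj U := MonIn.isProjObj_iff.trans MonIn.isInjObj_iff.symm

end Frobenius

/-! ### Simple modules and their annihilators. -/

section SimpleModules

variable {A : Type u} [Ring A]

/-- T is a quotient of the cyclic submodule of Sⁿ generated by the tuple s. That submodule is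
semisimple, so T embeds in Sⁿ and some coordinate is nonzero, hence bijective. -/
theorem exists_bijective_of_annihilator_le {ι S T : Type*} [Finite ι] [AddCommGroup S] [Module A S]
    [IsSimpleModule A S] [AddCommGroup T] [Module A T] [IsSimpleModule A T] (s : ι → S)
    (hs : ∀ a : A, (∀ i, a • s i = 0) → a ∈ Module.annihilator A S)
    (h : Module.annihilator A S ≤ Module.annihilator A T) :
    ∃ e : T →ₗ[A] S, Function.Bijective e := by
  let φ : A →ₗ[A] (ι → S) := LinearMap.pi fun i => LinearMap.toSpanSingleton A S (s i)
  have := IsSimpleModule.nontrivial A T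
  obtain ⟨t, ht⟩ := exists_ne (0 : T)
  obtain ⟨q, hq⟩ := exists_factor_of_surjective φ.surjective_rangeRestrict
    (LinearMap.toSpanSingleton A T t) (fun a ha => by
      have := h (hs a fun i => congrFun (congrArg Subtype.val ha) i)
      exact Module.mem_annihilator.1 this t)
  have hsurj : Function.Surjective q := fun x => by
    obtain ⟨a, rfl⟩ := IsSimpleModule.toSpanSingleton_surjective A ht x
    exact ⟨_, hq a⟩
  have hss : IsSemisimpleModule A (LinearMap.range φ) := inferInstance
  obtain ⟨σ, hσ⟩ := IsSemisimpleModule.lifting_property q hsurj LinearMap.id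
  obtain ⟨i, hi⟩ : ∃ i, LinearMap.proj i ∘ₗ (LinearMap.range φ).subtype ∘ₗ σ ≠ 0 := by
    by_contra! hcon
    have hσt : σ t = 0 := Subtype.ext (funext fun i => LinearMap.congr_fun (hcon i) t)
    have := LinearMap.congr_fun hσ t
    rw [LinearMap.comp_apply, hσt, map_zero] at this
    exact ht this.symm
  exact ⟨_, LinearMap.bijective_of_ne_zero hi⟩

theorem annihilator_eq_of_bijective {S T : Type*} [AddCommGroup S] [Module A S] [AddCommGroup T]
    [Module A T] {e : T →ₗ[A] S} (he : Function.Bijective e) :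
    Module.annihilator A T = Module.annihilator A S :=
  (LinearEquiv.ofBijective e he).annihilator_eq

theorem mul_mem_annihilator {S : Type*} [AddCommGroup S] [Module A S] {a : A}
    (ha : a ∈ Module.annihilator A S) (b : A) : a * b ∈ Module.annihilator A S := by
  rw [Module.mem_annihilator] at *
  intro s
  rw [mul_smul, ha]

/-- Primeness of the annihilator of T: if i and j act nontrivially on T, then so does j a i for some
a. -/
theorem le_annihilator_or_of_inf_le {T : Type*} [AddCommGroup T] [Module A T] [IsSimpleModule A T]
    {I J : Ideal A} (hJ : ∀ a ∈ J, ∀ b, a * b ∈ J) (h : J ⊓ I ≤ Module.annihilator A T) :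
    J ≤ Module.annihilator A T ∨ I ≤ Module.annihilator A T := by
  by_contra! hcon
  obtain ⟨i, hi, hiT⟩ := Set.not_subset.1 hcon.2
  obtain ⟨j, hj, hjT⟩ := Set.not_subset.1 hcon.1
  simp only [SetLike.mem_coe, Module.mem_annihilator, not_forall] at hiT hjT
  obtain ⟨t, ht⟩ := hiT
  obtain ⟨s, hs⟩ := hjT
  obtain ⟨a, rfl⟩ := IsSimpleModule.toSpanSingleton_surjective A ht s
  refine hs ?_
  have := Module.mem_annihilator.1 (h ⟨hJ j hj (a * i), by
    rw [← mul_assoc]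
    exact I.mul_mem_left _ hi⟩) t
  rwa [mul_smul, mul_smul] at this

variable (A) in
/-- The annihilators of simple modules. -/
def primitiveIdeals : Set (Ideal A) :=
  {I | ∃ S : ModuleCat.{u} A, IsSimpleModule A S ∧ Module.annihilator A S = I}

theorem exists_le_annihilator_of_finset_inf_le {T : Type*} [AddCommGroup T] [Module A T]
    [IsSimpleModule A T] (F : Finset (Ideal A)) (hF : ∀ I ∈ F, I ∈ primitiveIdeals A)
    (h : F.inf id ≤ Module.annihilator A T) : ∃ I ∈ F, I ≤ Module.annihilator A T := by
  classical
  induction F using Finset.induction_on with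
  | empty =>
    have := IsSimpleModule.nontrivial A T
    obtain ⟨t, ht⟩ := exists_ne (0 : T)
    refine absurd ?_ ht
    have := Module.mem_annihilator.1 (h (Submodule.mem_top : (1 : A) ∈ ⊤)) t
    rwa [one_smul] at this
  | insert J F _ ih =>
    rw [Finset.inf_insert, id] at h
    have hJ : ∀ a ∈ J, ∀ b, a * b ∈ J := by
      obtain ⟨S, -, rfl⟩ := hF J (Finset.mem_insert_self _ _)
      exact fun a ha b => mul_mem_annihilator ha b
    obtain h | h := le_annihilator_or_of_inf_le hJ h
    · exact ⟨J, Finset.mem_insert_self _ _, h⟩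
    · obtain ⟨I, hI, hle⟩ := ih (fun I hI => hF I (Finset.mem_insert_of_mem hI)) h
      exact ⟨I, Finset.mem_insert_of_mem hI, hle⟩

variable (k : Type u) [Field k] [Algebra k A] [FiniteDimensional k A]

include k in
theorem exists_bijective_of_annihilator_le_of_finite {S T : Type*} [AddCommGroup S] [Module A S]
    [IsSimpleModule A S] [AddCommGroup T] [Module A T] [IsSimpleModule A T]
    (h : Module.annihilator A S ≤ Module.annihilator A T) :
    ∃ e : T →ₗ[A] S, Function.Bijective e := by
  let _ : Module k S := Module.compHom S (algebraMap k A)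
  have hk : ∀ (c : k) (s : S), c • s = algebraMap k A c • s := fun _ _ => rfl
  have : IsScalarTower k A S := ⟨fun c b s => by
    rw [hk, smul_smul, Algebra.smul_def]⟩
  have : FiniteDimensional k S := Module.Finite.trans A S
  refine exists_bijective_of_annihilator_le (Module.finBasis k S) (fun a ha => ?_) h
  rw [Module.mem_annihilator]
  intro s
  rw [← (Module.finBasis k S).sum_repr s, Finset.smul_sum]
  refine Finset.sum_eq_zero fun i _ => ?_
  rw [smul_comm, ha, smul_zero]

-- Take a minimal finite intersection of primitive ideals. It lies in every primitive ideal, so by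
-- primeness each of them contains one of the finitely many chosen, and then equals it.
include k in
theorem finite_primitiveIdeals : (primitiveIdeals A).Finite := by
  classical
  have : IsArtinianRing A := IsArtinianRing.of_finite k A
  obtain ⟨_, ⟨F, hF, rfl⟩, hmin⟩ := set_has_minimal_iff_artinian.2 ‹IsArtinian A A›
    {I : Ideal A | ∃ F : Finset (Ideal A), (∀ I ∈ F, I ∈ primitiveIdeals A) ∧ F.inf id = I}
    ⟨⊤, ∅, by simp, rfl⟩
  refine F.finite_toSet.subset fun I hI => ?_
  obtain ⟨T, _, rfl⟩ := hI
  have hle : F.inf id ≤ Module.annihilator A T := by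
    have h1 := hmin _ ⟨insert (Module.annihilator A T) F, fun J hJ => by
      obtain rfl | hJ := Finset.mem_insert.1 hJ
      · exact ⟨T, ‹_›, rfl⟩
      · exact hF J hJ, rfl⟩
    rw [Finset.inf_insert, id, inf_lt_right, not_not] at h1
    exact h1
  obtain ⟨J, hJ, hle⟩ := exists_le_annihilator_of_finset_inf_le F hF hle
  obtain ⟨S, _, rfl⟩ := hF J hJ
  obtain ⟨e, he⟩ := exists_bijective_of_annihilator_le_of_finite k hle
  rwa [annihilator_eq_of_bijective he]

include k in
theorem annihilator_quotient_eq {S : Type*} [AddCommGroup S] [Module A S] [IsSimpleModule A S]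
    {M : Ideal A} [IsSimpleModule A (A ⧸ M)] (hS : Module.annihilator A S ≤ M) :
    Module.annihilator A (A ⧸ M) = Module.annihilator A S := by
  have hle : Module.annihilator A S ≤ Module.annihilator A (A ⧸ M) := fun a ha =>
    Module.mem_annihilator.2 fun x => by
      obtain ⟨b, rfl⟩ := Submodule.Quotient.mk_surjective _ x
      exact (Submodule.Quotient.mk_eq_zero M).2 (hS (mul_mem_annihilator ha b))
  obtain ⟨e, he⟩ := exists_bijective_of_annihilator_le_of_finite k hle
  exact annihilator_eq_of_bijective he

-- A maximal left ideal M containing both annihilators would make each equal to the annihilator of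
-- A/M.
include k in
theorem annihilator_sup_eq_top {S T : Type*} [AddCommGroup S] [Module A S]
    [IsSimpleModule A S] [AddCommGroup T] [Module A T] [IsSimpleModule A T]
    (h : Module.annihilator A S ≠ Module.annihilator A T) :
    Module.annihilator A S ⊔ Module.annihilator A T = ⊤ := by
  by_contra htop
  obtain ⟨M, hM, hle⟩ := Ideal.exists_le_maximal _ htop
  have : IsSimpleModule A (A ⧸ M) := isSimpleModule_iff_isCoatom.2 hM.out
  exact h ((annihilator_quotient_eq k (le_sup_left.trans hle)).symm.trans
    (annihilator_quotient_eq k (le_sup_right.trans hle)))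

end SimpleModules

/-! ### Selfinjective algebras: every finitely generated module is Gorenstein projective. -/

section SelfInjective

variable {A : Type u} [Ring A]

/-- The homomorphisms `M → A` that are sums of homomorphisms `x ↦ g x * n` with `n ∈ I`. -/
def homMul (I : Ideal A) (M : Type u) [AddCommGroup M] [Module A M] : AddSubgroup (M →ₗ[A] A) :=
  AddSubgroup.closure {f | ∃ (g : M →ₗ[A] A) (n : A), n ∈ I ∧
    f = LinearMap.toSpanSingleton A A n ∘ₗ g}

variable {I : Ideal A} {M N : Type u} [AddCommGroup M] [Module A M] [AddCommGroup N] [Module A N]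

theorem homMul_comp {f : M →ₗ[A] A} (hf : f ∈ homMul I M) (p : N →ₗ[A] M) :
    f ∘ₗ p ∈ homMul I N := by
  have : homMul I M ≤ (homMul I N).comap
      (AddMonoidHom.mk' (fun f => f ∘ₗ p) fun f g => LinearMap.add_comp _ _ _) := by
    refine (AddSubgroup.closure_le _).2 ?_
    rintro _ ⟨g, n, hn, rfl⟩
    exact AddSubgroup.subset_closure ⟨g ∘ₗ p, n, hn, rfl⟩
  exact this hf

theorem exists_homMul_extend (hA : Module.Injective A A) {f : N →ₗ[A] A} (hf : f ∈ homMul I N)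
    {i : N →ₗ[A] M} (hi : Function.Injective i) : ∃ g ∈ homMul I M, g ∘ₗ i = f := by
  have : homMul I N ≤ (homMul I M).map
      (AddMonoidHom.mk' (fun f => f ∘ₗ i) fun f g => LinearMap.add_comp _ _ _) := by
    refine (AddSubgroup.closure_le _).2 ?_
    rintro _ ⟨g, n, hn, rfl⟩
    obtain ⟨h, hh⟩ := hA.out i hi g
    refine ⟨_, AddSubgroup.subset_closure ⟨h, n, hn, rfl⟩, LinearMap.ext fun x => ?_⟩
    exact congrArg (· • n) (hh x)
  exact this hf

/-- Induction on length: extend the restriction to N within `homMul` by injectivity of A; the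
difference factors through the simple quotient. -/
theorem mem_homMul_of_isFiniteLength (hA : Module.Injective A A)
    (h : ∀ (S : Type u) [AddCommGroup S] [Module A S] [IsSimpleModule A S] (f : S →ₗ[A] A),
      f ∈ homMul I S) (hM : IsFiniteLength A M) (f : M →ₗ[A] A) : f ∈ homMul I M := by
  induction hM with
  | of_subsingleton =>
    rw [show f = 0 from LinearMap.ext fun x => by rw [Subsingleton.elim x 0, map_zero, map_zero]]
    exact zero_mem _
  | @of_simple_quotient M _ _ N _ _ ih =>
    obtain ⟨g, hg, hgf⟩ := exists_homMul_extend hA (ih (f ∘ₗ N.subtype)) N.injective_subtype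
    have hle : N ≤ LinearMap.ker (f - g) := fun x hx => by
      have := LinearMap.congr_fun hgf ⟨x, hx⟩
      exact sub_eq_zero.2 this.symm
    have h1 := homMul_comp (h _ (N.liftQ (f - g) hle)) N.mkQ
    rw [Submodule.liftQ_mkQ] at h1
    exact (sub_add_cancel f g) ▸ add_mem h1 hg

variable (k : Type u) [Field k] [Algebra k A] [FiniteDimensional k A]

-- Otherwise every simple S with a nonzero map to A has an embedding g · n with n in I = ann T. By
-- injectivity every map S → A is q ∘ (g · n) = g · (n q(1)), which lies in `homMul I`. By length so
-- does the identity of A, giving 1 ∈ I.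
include k in
theorem exists_simple_hom_mul_eq_zero (hA : Module.Injective A A) (T : Type u) [AddCommGroup T]
    [Module A T] [IsSimpleModule A T] : ∃ S : ModuleCat.{u} A, IsSimpleModule A S ∧
      (∃ f : S →ₗ[A] A, f ≠ 0) ∧
      ∀ (f : S →ₗ[A] A) (s : S) (n : A), n ∈ Module.annihilator A T → f s * n = 0 := by
  have : IsArtinianRing A := IsArtinianRing.of_finite k A
  have : IsNoetherianRing A := IsNoetherianRing.of_finite k A
  by_contra! hcon
  have h : ∀ (S : Type u) [AddCommGroup S] [Module A S] [IsSimpleModule A S] (f : S →ₗ[A] A),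
      f ∈ homMul (Module.annihilator A T) S := by
    intro S _ _ _ f
    by_cases hf : f = 0
    · exact hf ▸ zero_mem _
    obtain ⟨g, s, n, hn, hgn⟩ := hcon (ModuleCat.of A S) ‹_› ⟨f, hf⟩
    have hne : LinearMap.toSpanSingleton A A n ∘ₗ g ≠ 0 := fun h0 =>
      hgn (LinearMap.congr_fun h0 s)
    obtain ⟨q, hq⟩ := hA.out (LinearMap.toSpanSingleton A A n ∘ₗ g)
      (LinearMap.injective_of_ne_zero hne) f
    refine AddSubgroup.subset_closure ⟨g, n * q 1, mul_mem_annihilator hn _,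
      LinearMap.ext fun x => ?_⟩
    rw [← hq x]
    change q (g x * n) = g x * (n * q 1)
    rw [← mul_assoc, ← smul_eq_mul (g x * n) (q 1), ← map_smul, smul_eq_mul, mul_one]
  have h1 := mem_homMul_of_isFiniteLength hA h
    (isFiniteLength_iff_isNoetherian_isArtinian.2 ⟨inferInstance, inferInstance⟩)
    (LinearMap.id : A →ₗ[A] A)
  have h2 : homMul (Module.annihilator A T) A ≤ (Module.annihilator A T).toAddSubgroup.comap
      (AddMonoidHom.mk' (fun f => f 1) fun f g => rfl) := by
    refine (AddSubgroup.closure_le _).2 ?_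
    rintro _ ⟨g, n, hn, rfl⟩
    exact Ideal.mul_mem_left _ (g 1) hn
  have := IsSimpleModule.nontrivial A T
  obtain ⟨t, ht⟩ := exists_ne (0 : T)
  have h3 : (1 : A) • t = 0 := Module.mem_annihilator.1 (h2 h1) t
  exact ht (by rwa [one_smul] at h3)

include k in
/-- Over a finite dimensional selfinjective algebra, every simple module embeds into the
algebra. -/
theorem exists_hom_ne_zero_of_isSimpleModule (hA : Module.Injective A A) (S : Type u)
    [AddCommGroup S] [Module A S] [IsSimpleModule A S] : ∃ f : S →ₗ[A] A, f ≠ 0 := by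
  have hex : ∀ I : primitiveIdeals A, ∃ S : ModuleCat.{u} A, IsSimpleModule A S ∧
      (∃ f : S →ₗ[A] A, f ≠ 0) ∧ ∀ (f : S →ₗ[A] A) (s : S) (n : A), n ∈ I.1 → f s * n = 0 := by
    rintro ⟨_, T, _, rfl⟩
    exact exists_simple_hom_mul_eq_zero k hA T
  choose ν hsimple hne hzero using hex
  -- A Nakayama-type permutation: I is sent to the annihilator of a simple module ν I that embeds in
  -- A with image killed by I on the right. Distinct I and J cannot share ν, since I + J = A would
  -- kill its image. As the set is finite, every simple module occurs as some ν I.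
  let φ : primitiveIdeals A → primitiveIdeals A := fun I =>
    ⟨Module.annihilator A (ν I), ν I, hsimple I, rfl⟩
  have hφ : Function.Injective φ := by
    intro I J hIJ
    by_contra hcon
    obtain ⟨e, he⟩ := exists_bijective_of_annihilator_le_of_finite k (congrArg Subtype.val hIJ).le
    obtain ⟨f, hf⟩ := hne I
    have htop : I.1 ⊔ J.1 = ⊤ := by
      obtain ⟨_, T, _, rfl⟩ := I
      obtain ⟨_, T', _, rfl⟩ := J
      exact annihilator_sup_eq_top k fun h => hcon (Subtype.ext h)
    refine hf (LinearMap.ext fun s => ?_)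
    obtain ⟨t, rfl⟩ := he.2 s
    obtain ⟨a, ha, b, hb, hab⟩ := Submodule.mem_sup.1
      (htop ▸ Submodule.mem_top : (1 : A) ∈ I.1 ⊔ J.1)
    have h1 := hzero I f (e t) a ha
    have h2 := hzero J (f ∘ₗ e) t b hb
    rw [← mul_one (f (e t)), ← hab, mul_add, h1, zero_add]
    exact h2
  have := (finite_primitiveIdeals (A := A) k).to_subtype
  obtain ⟨I, hI⟩ := Finite.injective_iff_surjective.1 hφ
    ⟨Module.annihilator A S, ModuleCat.of A S, ‹_›, rfl⟩
  obtain ⟨e, he⟩ := exists_bijective_of_annihilator_le_of_finite k (congrArg Subtype.val hI).le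
  obtain ⟨f, hf⟩ := hne I
  refine ⟨f ∘ₗ e, fun h => hf (LinearMap.ext fun s => ?_)⟩
  obtain ⟨t, rfl⟩ := he.2 s
  exact LinearMap.congr_fun h t

-- A simple quotient of the cyclic module A m embeds in A; the resulting map A m → A is nonzero at m
-- and extends to M.
include k in
theorem exists_hom_apply_ne_zero (hA : Module.Injective A A) {m : M} (hm : m ≠ 0) :
    ∃ f : M →ₗ[A] A, f m ≠ 0 := by
  let p := LinearMap.toSpanSingleton A M m
  obtain ⟨P, hP, hle⟩ := Ideal.exists_le_maximal (LinearMap.ker p) fun htop => hm (by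
    have : (1 : A) ∈ LinearMap.ker p := htop ▸ Submodule.mem_top
    simpa [p] using this)
  have hsimple : IsSimpleModule A (A ⧸ P) := isSimpleModule_iff_isCoatom.2 hP.out
  obtain ⟨h, hh⟩ := exists_factor_of_surjective p.surjective_rangeRestrict P.mkQ fun a ha =>
    (Submodule.Quotient.mk_eq_zero P).2 (hle (congrArg Subtype.val ha))
  obtain ⟨f, hf⟩ := exists_hom_ne_zero_of_isSimpleModule k hA (A ⧸ P)
  obtain ⟨g, hg⟩ := hA.out (LinearMap.range p).subtype (Submodule.injective_subtype _) (f ∘ₗ h)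
  refine ⟨g, fun h0 => ?_⟩
  have h1 := hg (p.rangeRestrict 1)
  rw [LinearMap.comp_apply, hh] at h1
  have h2 : (LinearMap.range p).subtype (p.rangeRestrict 1) = m := one_smul A m
  rw [h2, h0] at h1
  have h3 : P.mkQ 1 = 0 := LinearMap.injective_of_ne_zero hf (h1.symm.trans (map_zero f).symm)
  exact hP.ne_top ((Ideal.eq_top_iff_one P).2 ((Submodule.Quotient.mk_eq_zero P).1 h3))

-- Among kernels of maps M → Aⁿ choose a minimal one; a nonzero element of it would be separated by
-- one further functional.
include k in
theorem exists_injective_pi_of_injective (hA : Module.Injective A A) [Module.Finite A M] :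
    ∃ (n : ℕ) (f : M →ₗ[A] (Fin n → A)), Function.Injective f := by
  have : IsArtinianRing A := IsArtinianRing.of_finite k A
  obtain ⟨_, ⟨n, f, rfl⟩, hmin⟩ := set_has_minimal_iff_artinian.2 (inferInstance : IsArtinian A M)
    {N : Submodule A M | ∃ (n : ℕ) (f : M →ₗ[A] (Fin n → A)), LinearMap.ker f = N} ⟨_, 0, 0, rfl⟩
  refine ⟨n, f, (injective_iff_map_eq_zero f).2 fun m hm => ?_⟩
  by_contra hne
  obtain ⟨g, hg⟩ := exists_hom_apply_ne_zero k hA hne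
  let F : M →ₗ[A] (Fin (n + 1) → A) := LinearMap.pi (Fin.cons g fun i => LinearMap.proj i ∘ₗ f)
  have hF0 : ∀ x, F x 0 = g x := fun x => rfl
  have hFs : ∀ x i, F x (Fin.succ i) = f x i := fun x i => rfl
  refine hmin _ ⟨n + 1, F, rfl⟩ (lt_of_le_of_ne (fun x hx => ?_) fun heq => ?_)
  · exact funext fun i => (hFs x i).symm.trans (congrFun hx _)
  · have : m ∈ LinearMap.ker F := heq ▸ hm
    exact hg ((hF0 m).symm.trans (congrFun this 0))

include k in
/-- Over a finite dimensional selfinjective algebra, every finitely generated module is Gorenstein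
projective. -/
theorem gproj_of_injective (hA : Module.Injective A A) {G : ModuleCat.{u} A} [Module.Finite A G] :
    Gproj A G := by
  have : IsNoetherianRing A := IsNoetherianRing.of_finite k A
  have key : IsGorensteinClass fun G : ModuleCat.{u} A => Module.Finite A G := by
    intro G hG
    refine ⟨fun Y _ _ g _ f => hA.out _ (LinearMap.ker g).injective_subtype f, ?_, ?_⟩
    · obtain ⟨n, f, hf⟩ := exists_injective_pi_of_injective (M := G) k hA
      exact ⟨ModuleCat.of A (_ ⧸ LinearMap.range f),
        inferInstanceAs (Module.Finite A (_ ⧸ LinearMap.range f)), ModuleCat.of A (Fin n → A),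
        f, _, inferInstanceAs (Module.Finite A (Fin n → A)),
        inferInstanceAs (Module.Projective A (Fin n → A)), isSES_range hf⟩
    · obtain ⟨n, p, hp⟩ := Module.Finite.exists_fin' A G
      exact ⟨ModuleCat.of A (LinearMap.ker p), inferInstanceAs (Module.Finite A (LinearMap.ker p)),
        ModuleCat.of A (Fin n → A), _, p, inferInstanceAs (Module.Finite A (Fin n → A)),
        inferInstanceAs (Module.Projective A (Fin n → A)), isSES_ker hp⟩
  exact key.le_gproj ‹_›

end SelfInjective

/-! ### The equivalence with selfinjectivity of A. -/

section SelfInjectiveIff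

theorem IsInjObj.extend {R : Type u} [Ring R] {L : ObjectProperty (ModuleCat.{u} R)}
    {U X Y Z : ModuleCat.{u} R} (hU : IsInjObj L U) {f : X →ₗ[R] Y} {g : Y →ₗ[R] Z}
    (s : IsSES f g) (hX : L X) (hY : L Y) (hZ : L Z) (w : X →ₗ[R] U) :
    ∃ v : Y →ₗ[R] U, ∀ x, v (f x) = w x := by
  obtain ⟨v, hv⟩ := hU.2 s.shortComplex ⟨s.shortExact, hX, hY, hZ⟩ (ModuleCat.ofHom w)
  exact ⟨v.hom, fun x => LinearMap.congr_fun (congrArg ModuleCat.Hom.hom hv) x⟩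

variable {k A B : Type u} [Field k] [Ring A] [Algebra k A] [Ring B] [Algebra k B]

theorem exists_isSES_coind_right (V : Type u) [AddCommGroup V] [Module k V] [Module Bᵐᵒᵖ V]
    [IsScalarTower k Bᵐᵒᵖ V] (I : Ideal A) :
    ∃ (F : Coind k V I →ₗ[A ⊗[k] B] Coind k V A) (G : Coind k V A →ₗ[A ⊗[k] B] Coind k V (A ⧸ I)),
      IsSES F G ∧ ∀ h v, F h v = h v := by
  obtain ⟨F, hF⟩ := exists_coind_map_right (k := k) (B := B) (V := V) (Submodule.subtype I)
  obtain ⟨G, hG⟩ := exists_coind_map_right (k := k) (B := B) (V := V) (Submodule.mkQ I)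
  refine ⟨F, G, ⟨fun h h' hh => coind_ext fun v => Subtype.ext ?_,
    exists_coind_lift I.mkQ_surjective hG, fun h => ⟨fun hh => ?_, ?_⟩⟩, hF⟩
  · exact (hF h v).symm.trans ((congrArg (fun f => f v) hh).trans (hF h' v))
  · have hmem : ∀ v, h v ∈ I := fun v =>
      (Submodule.Quotient.mk_eq_zero I).1 ((hG h v).symm.trans (congrArg (fun f => f v) hh))
    exact ⟨LinearMap.codRestrict (I.restrictScalars k) (show V →ₗ[k] A from h) hmem,
      coind_ext fun v => hF _ v⟩
  · rintro ⟨h, rfl⟩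
    refine coind_ext fun v => (hG _ v).trans ?_
    rw [hF]
    exact (Submodule.Quotient.mk_eq_zero I).2 (h v).2

/-- The constant `a` in `Hom_k(D(B), N)`, sending `φ` to `φ(1) a`. -/
def coindConst (k B : Type u) [Field k] [Ring B] [Algebra k B] {N : Type u} [AddCommGroup N]
    [Module k N] (a : N) : Coind k (RightDual k B) N :=
  (LinearMap.toSpanSingleton k N a ∘ₗ LinearMap.applyₗ (1 : B) : (B →ₗ[k] k) →ₗ[k] N)

theorem coindConst_apply {N : Type u} [AddCommGroup N] [Module k N] (a : N) (φ : RightDual k B) :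
    coindConst k B a φ = (show B →ₗ[k] k from φ) 1 • a := rfl

variable [FiniteDimensional k A] [FiniteDimensional k B]

/-- Baer's criterion: coinduction turns I → A → A/I into a conflation of Mon(B, A), since all
Hom_k(D(B), N) are B-projective. The coinduced g extends to w, and an extension of g is recovered by
evaluating w on constants. -/
theorem injective_of_isInjObj_coind [Nontrivial B]
    (h : IsInjObj (Mon k A B) (ModuleCat.of (A ⊗[k] B) (Coind k (RightDual k B) A))) :
    Module.Injective A A := by
  have := isNoetherianRing_tensor (k := k) (A := A) (B := B)
  refine Module.Baer.injective fun I g => ?_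
  obtain ⟨F, G, s, hF⟩ := exists_isSES_coind_right (k := k) (B := B) (RightDual k B) I
  obtain ⟨g', hg'⟩ := exists_coind_map_right (k := k) (B := B) (V := RightDual k B) g
  obtain ⟨w, hw⟩ := h.extend (X := ModuleCat.of (A ⊗[k] B) (Coind k (RightDual k B) I))
    (Y := ModuleCat.of (A ⊗[k] B) (Coind k (RightDual k B) A))
    (Z := ModuleCat.of (A ⊗[k] B) (Coind k (RightDual k B) (A ⧸ I))) s
    (mon_iff.2 ⟨Module.Finite.of_injective F s.inj,
      inferInstanceAs (Module.Projective B (ResB k A B (Coind k (RightDual k B) I)))⟩) h.1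
    (mon_iff.2 ⟨Module.Finite.of_surjective G s.surj,
      inferInstanceAs (Module.Projective B (ResB k A B (Coind k (RightDual k B) (A ⧸ I))))⟩) g'
  -- A functional with φ(1) = 1 exists because B is nonzero; evaluation at φ undoes `coindConst`.
  obtain ⟨φ, hφ⟩ := (LinearMap.toSpanSingleton k B 1).exists_leftInverse_of_injective
    (LinearMap.ker_eq_bot.2 fun c d hcd => smul_left_injective k (one_ne_zero (α := B)) hcd)
  have hφ1 : φ 1 = 1 := by simpa using LinearMap.congr_fun hφ 1
  have key : ∀ a b : A, coindConst k B (a * b) = (a ⊗ₜ[k] (1 : B)) • coindConst k B b :=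
    fun a b => coind_ext fun ψ => by
      rw [coind_smul_apply, MulOpposite.op_one, one_smul, coindConst_apply, coindConst_apply,
        ← mul_smul_comm, smul_eq_mul]
  let f : A →ₗ[A] A :=
    { toFun := fun a => w (coindConst k B a) (show RightDual k B from φ)
      map_add' := fun a b => by
        have : coindConst k B (a + b) = coindConst k B a + coindConst k B b :=
          coind_ext fun ψ => smul_add _ a b
        rw [this, map_add]
        rfl
      map_smul' := fun a b => by
        rw [smul_eq_mul, key, map_smul]
        refine (coind_smul_apply a 1 _ _).trans ?_
        rw [MulOpposite.op_one, one_smul]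
        rfl }
  refine ⟨f, fun a ha => ?_⟩
  have h1 : coindConst k B a = F (coindConst k B (⟨a, ha⟩ : I)) :=
    coind_ext fun ψ => (hF (coindConst k B ⟨a, ha⟩) ψ).symm
  change w (coindConst k B a) (show RightDual k B from φ) = _
  rw [h1]
  refine (congrArg (fun f : Coind k (RightDual k B) A => f φ) (hw _)).trans ?_
  refine (hg' _ _).trans (congrArg g ?_)
  exact (congrArg (· • (⟨a, ha⟩ : I)) hφ1).trans (one_smul k _)

theorem injective_of_isFrobeniusExact_mon [Nontrivial B] (h : IsFrobeniusExact (Mon k A B)) :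
    Module.Injective A A :=
  injective_of_isInjObj_coind ((h.proj_iff_inj _).1 (isProjObj_of_projective
    (P := ModuleCat.of (A ⊗[k] B) (Coind k (RightDual k B) A)) mon_of_projective))

theorem mon_eq_monIn_of_injective (hA : Module.Injective A A) :
    Mon k A B = MonIn k A B (Gproj A) := by
  refine funext fun X => propext ⟨fun h => ⟨h, fun V _ _ _ _ _ => ?_⟩, fun h => h.1⟩
  have := h.1
  have : FiniteDimensional k V := finiteDimensional_of_op (B := B)
  exact gproj_of_injective k hA (G := ModuleCat.of A (IndTensor k A B V X))

end SelfInjectiveIff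

end

end MonRep

/-! ### The theorem. -/

theorem mainTheorem7 (k A B : Type u) [Field k] [Ring A] [Algebra k A] [FiniteDimensional k A]
    [Ring B] [Algebra k B] [FiniteDimensional k B] :
    MonRep.IsFrobeniusExact (MonRep.MonIn k A B (MonRep.Gproj A)) ∧
    (∀ U : ModuleCat.{u} (A ⊗[k] B),
      (MonRep.IsProjObj (MonRep.MonIn k A B (MonRep.Gproj A)) U ∧
        MonRep.IsInjObj (MonRep.MonIn k A B (MonRep.Gproj A)) U) ↔
      (Module.Finite (A ⊗[k] B) U ∧ Module.Projective (A ⊗[k] B) U)) ∧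
    (Nontrivial B →
      List.TFAE [
        MonRep.IsFrobeniusExact (MonRep.Mon k A B),
        Module.Injective A A,
        MonRep.Mon k A B = MonRep.MonIn k A B (MonRep.Gproj A)]) := by
  refine ⟨MonRep.isFrobeniusExact_monIn k A B, fun U => ⟨fun h => MonRep.MonIn.isProjObj_iff.1 h.1,
    fun h => ⟨MonRep.MonIn.isProjObj_iff.2 h, MonRep.MonIn.isInjObj_iff.2 h⟩⟩, fun _ => ?_⟩
  tfae_have 1 → 2 := MonRep.injective_of_isFrobeniusExact_mon
  tfae_have 2 → 3 := MonRep.mon_eq_monIn_of_injective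
  tfae_have 3 → 1 := fun h => h ▸ MonRep.isFrobeniusExact_monIn k A B
  tfae_finish
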